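/- Let $d\ge 2$, $n\ge 1$, $\mathcal X=\{x\in\mathbb R^d : \sum_i x^{(i)}\le 1,\ x^{(i)}\ge 0\}$, $\mathcal S=\{x : x^{(i)}>0 \text{ for all } i\}$, let $\omega(x)=\sum_{i=1}^d x^{(i)}\log x^{(i)}$ be the Shannon entropy and $D_\omega(x,y)=\omega(x)-\omega(y)-\langle\nabla\omega(y),x-y\rangle$. Let $f(\cdot,\xi)$ be differentiable on $\mathcal X\cap\mathcal S$ for every data point $\xi$, and let $r:\mathbb R^d\to\mathbb R$ be convex. For a dataset $S=(\xi^1,\dots,\xi^n)$ put $F_S(x)=\sum_{i=1}^n f(x,\xi^i)$, $\Phi_S=F_S+r$, $\Phi_S^*=\inf_{\mathcal X}\Phi_S$, and assume $\|\nabla F_S(x)\|_2\le G$ for all $S$ and all $x\in\mathcal X\cap\mathcal S$, where $G>0$. For $\rho>0$ let $$\mathcal D_\rho(x)=-2\rho\min_{y\in\mathcal X}\big[\langle\nabla F_S(x),y-x\rangle+\rho D_\omega(y,x)+r(y)-r(x)\big].$$ DP mirror descent starts at a point $x_0\in\mathcal X\cap\mathcal S$ that does not depend on the data, runs $$x_{t+1}=\operatorname*{argmin}_{y\in\mathcal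 X}\ \eta\big(\langle\nabla F_S(x_t)+b_t,y\rangle+r(y)\big)+D_\omega(y,x_t),\qquad b_t\sim\mathcal N(0,\sigma_G^2 I_d)\ \text{i.i.d.},$$ with $\eta=\frac1{2\ell}$ ($\ell>0$) for $T$ steps, and outputs all iterates $x_0,\dots,x_T$. For every $c_1>0$ there is $c_2>0$ depending only on $c_1$, and for every $\beta_0\in(0,1)$ there is $C>0$ depending only on $c_1$ and $\beta_0$, such that the following holds for all $\delta\in(0,1)$, $0<\epsilon\le c_1\log(1/\delta)$, $\beta\in(0,\beta_0]$ and $\Lambda>0$. Put $$T=\left\lceil\frac{n\epsilon\sqrt{\ell\Lambda}}{G\sqrt{\log(d)\log(1/\delta)\log(1/\beta)}}\right\rceil,\qquad \sigma_G^2=c_2\,\frac{G^2\,T\log(1/\delta)}{n^2\epsilon^2}.$$ 1. DP mirror descent is $(\epsilon,\delta)$-differentially private: for all datasets $S,S'$ that differ in exactly one data point and all measurable sets $A$ of outputs, $\Pr((x_0,\dots,x_T)(S)\in A)\le e^{\epsilon}\Pr((x_0,\dots,x_T)(S')\in A)+\delta$. 2. Let $S$ be a dataset for which $\Phi_S^*>-\infty$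 and $F_S$ is $(\ell,\omega)$-smooth, that is, $|F_S(x)-F_S(y)-\langle\nabla F_S(y),x-y\rangle|\le\ell D_\omega(x,y)$ for all $x,y\in\mathcal X\cap\mathcal S$, and let $\lambda_0=\Phi_S(x_0)-\Phi_S^*$. If $\Lambda=\lambda_0$, then with probability at least $1-\beta$ $$\frac1T\sum_{t=0}^{T-1}\mathcal D_{5\ell}(x_t)\le C\,\frac{G\sqrt{\ell\lambda_0\log(d)\log(1/\delta)\log(1/\beta)}}{n\epsilon},$$ and for every $\Lambda>0$, with probability at least $1-\beta$, $$\frac1T\sum_{t=0}^{T-1}\mathcal D_{5\ell}(x_t)\le C\,\frac{G\sqrt{\ell\log(d)\log(1/\delta)\log(1/\beta)}}{n\epsilon}\Big(\sqrt{\Lambda}+\frac{\lambda_0}{\sqrt{\Lambda}}\Big).$$ -/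

import Mathlib

open Set MeasureTheory ProbabilityTheory
open scoped NNReal ENNReal

noncomputable section

namespace DPMD

/-- Euclidean space of dimension `d`. -/
abbrev E (d : ℕ) : Type := EuclideanSpace ℝ (Fin d)

/-- The unit simplex `{x | ∑ xᵢ ≤ 1, xᵢ ≥ 0}`. -/
def simplex (d : ℕ) : Set (E d) := {x | ∑ i, x i ≤ 1 ∧ ∀ i, 0 ≤ x i}

/-- The zone of the Shannon entropy: the open positive orthant. -/
def zone (d : ℕ) : Set (E d) := {x | ∀ i, 0 < x i}

/-- Shannon entropy `ω(x) = ∑ xᵢ log xᵢ` (with `0 log 0 = 0`). -/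
def entropy {d : ℕ} (x : E d) : ℝ := ∑ i, x i * Real.log (x i)

/-- The Bregman divergence `D_ω(x, y) = ω(x) - ω(y) - ⟨∇ω(y), x - y⟩` of the Shannon entropy,
for `x` in the closed orthant and `y` in the zone. -/
def bregman {d : ℕ} (x y : E d) : ℝ :=
  entropy x - entropy y - inner ℝ (gradient (entropy (d := d)) y) (x - y)

/-- The gradient of `F`, as a function on `simplex ∩ zone` (a convex set with nonempty interior,
so that the gradient within it is unique). -/
def grad {d : ℕ} (F : E d → ℝ) (x : E d) : E d := gradientWithin F (simplex d ∩ zone d) x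

/-- `F` is `(ℓ, ω)`-smooth: differentiable and `ℓ`-relatively smooth w.r.t. the entropy on
`simplex ∩ zone`. -/
def RelSmooth {d : ℕ} (l : ℝ) (F : E d → ℝ) : Prop :=
  DifferentiableOn ℝ F (simplex d ∩ zone d) ∧
    ∀ x ∈ simplex d ∩ zone d, ∀ y ∈ simplex d ∩ zone d,
      -(l * bregman x y) ≤ F x - F y - inner ℝ (grad F y) (x - y) ∧
        F x - F y - inner ℝ (grad F y) (x - y) ≤ l * bregman x y

/-- The Bregman forward-backward envelope
`𝒟_ρ(x) = -2ρ min_{y ∈ X} (⟨∇F(x), y - x⟩ + ρ D_ω(y, x) + r(y) - r(x))`.  For `x` in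
`simplex ∩ zone` and a finite convex `r` the minimum of this continuous function of `y` over the
compact simplex is attained, so it is the infimum. -/
def bfbe {d : ℕ} (F r : E d → ℝ) (ρ : ℝ) (x : E d) : ℝ :=
  -2 * ρ * sInf ((fun y : E d => inner ℝ (grad F x) (y - x) + ρ * bregman y x + r y - r x) ''
    simplex d)

/-- The empirical loss `F_S(x) = ∑ᵢ f(x, ξⁱ)` of the dataset `S = (ξ¹, …, ξⁿ)`. -/
def empLoss {Ξ : Type*} {d n : ℕ} (f : E d → Ξ → ℝ) (S : Fin n → Ξ) (x : E d) : ℝ :=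
  ∑ i, f x (S i)

/-- The initial gap `λ₀ = Φ(x₀) - Φ*`, with `Φ = F + r` and `Φ* = inf_X Φ`. -/
def gap {d : ℕ} (F r : E d → ℝ) (x₀ : E d) : ℝ :=
  (F x₀ + r x₀) - sInf ((fun x : E d => F x + r x) '' simplex d)

/-- One mirror descent step `argmin_{y ∈ X} η (⟨g, y⟩ + r(y)) + D_ω(y, x)`.  For `x` in
`simplex ∩ zone` and a finite convex `r` the minimizer exists, is unique and lies in
`simplex ∩ zone`. -/
def mdStep {d : ℕ} (r : E d → ℝ) (η : ℝ) (x g : E d) : E d :=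
  Classical.epsilon fun z : E d => z ∈ simplex d ∧
    IsMinOn (fun y : E d => η * (inner ℝ g y + r y) + bregman y x) (simplex d) z

/-- The iterates of mirror descent on `F + r` from `x₀` with constant step size `η`, when `b t`
is added to the gradient in step `t`. -/
def iter {d : ℕ} (F r : E d → ℝ) (η : ℝ) (x₀ : E d) (b : ℕ → Fin d → ℝ) : ℕ → E d
  | 0 => x₀
  | t + 1 => mdStep r η (iter F r η x₀ b t)
      (grad F (iter F r η x₀ b t) + WithLp.toLp 2 (b t))

/-- The law of a sequence of independent `N(0, v I_d)` vectors (`v` is the variance). -/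
def noise (d : ℕ) (v : ℝ≥0) : Measure (ℕ → Fin d → ℝ) :=
  Measure.infinitePi fun _ : ℕ => Measure.pi fun _ : Fin d => gaussianReal 0 v

/-- The output of DP mirror descent with `T` iterations on the dataset `S`: all the iterates
`x₀, …, x_T`, as a function of the noise. -/
def dpmd {Ξ : Type*} {d n : ℕ} (f : E d → Ξ → ℝ) (r : E d → ℝ) (η : ℝ) (x₀ : E d) (T : ℕ)
    (S : Fin n → Ξ) (b : ℕ → Fin d → ℝ) : Fin (T + 1) → E d :=
  fun t => iter (empLoss f S) r η x₀ b t

/-- Two datasets that differ in exactly one data point. -/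
def Neighbors {Ξ : Type*} {n : ℕ} (S S' : Fin n → Ξ) : Prop :=
  ∃ i, S i ≠ S' i ∧ ∀ j, j ≠ i → S j = S' j

/-- `(ε, δ)`-differential privacy of a randomized algorithm `M`, whose randomness has law `P`. -/
def IsDP {Ξ Ω Y : Type*} {n : ℕ} [MeasurableSpace Ω] [MeasurableSpace Y] (P : Measure Ω)
    (M : (Fin n → Ξ) → Ω → Y) (ε δ : ℝ) : Prop :=
  ∀ S S' : Fin n → Ξ, Neighbors S S' → ∀ A : Set Y, MeasurableSet A →
    P {ω | M S ω ∈ A} ≤ ENNReal.ofReal (Real.exp ε) * P {ω | M S' ω ∈ A} + ENNReal.ofReal δ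

end DPMD

end

/-! Utility is a pathwise estimate. The entropy is strongly convex in the `ℓ¹` norm on the simplex
(`sq_sum_abs_le_bregman`), and the three-point inequality `mdStep_three_point` compares the new
iterate `z` with every competitor `y`, leaving a spare term `2 * l * bregman y z`. In the descent
estimate the noise enters through `⟨b, y - z⟩`, at most the sup-norm of `b` times the `ℓ¹` distance
of `y` and `z`, so the spare term absorbs it at the price of `‖b‖ ^ 2 / (2 * l)`. Relative
smoothness then gives `bfbe_le_step`, which telescopes to `sum_bfbe_le`. No martingale argument is
needed: only the sum of the squared sup-norms has to be controlled, by an exponential moment and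
Markov's inequality (`noise_sum_norm_sq_le`). The sup-norm is what makes the dimension enter through
`log d`.

Privacy is a change of variables in the noise. Adding to `b t` the difference of the two gradients
at the current iterate turns the run on `S` into the run on `S'` (`iter_shift`). This translation is
adaptive but bounded by the sensitivity `2 * G / n`. A Gaussian translation costs a factor in a
Hölder inequality, and these factors multiply over the steps because each translation depends on
earlier noise only (`lintegral_adaptive_shift_le`). Young's inequality turns the resulting
Rényi-type bound into an `(ε, δ)` bound (`le_exp_mul_add_of_rpow`).

The variance grows linearly in `T`, so the average error has one term of order `1 / T` and one of
order `T`. The chosen `T` balances them (`average_bound`), except when rounding up to `T = 1` makes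
the second too large; then only the deterministic `x₀` is averaged and the noise is irrelevant. -/

namespace DPMD

variable {d : ℕ}

/-! ### Entropy and Bregman divergence -/

theorem hasFDerivAt_entropy {y : E d} (hy : y ∈ zone d) :
    HasFDerivAt (entropy (d := d))
      (∑ i, (Real.log (y i) + 1) • (EuclideanSpace.proj i : E d →L[ℝ] ℝ)) y := by
  unfold entropy
  refine HasFDerivAt.fun_sum fun i _ => ?_
  exact (Real.hasDerivAt_mul_log (hy i).ne').comp_hasFDerivAt y
    (EuclideanSpace.proj i : E d →L[ℝ] ℝ).hasFDerivAt

theorem gradient_entropy {y : E d} (hy : y ∈ zone d) (i : Fin d) :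
    gradient (entropy (d := d)) y i = Real.log (y i) + 1 := by
  have h : inner ℝ (gradient (entropy (d := d)) y) (EuclideanSpace.single i (1 : ℝ)) =
      fderiv ℝ (entropy (d := d)) y (EuclideanSpace.single i (1 : ℝ)) := by
    rw [gradient, InnerProductSpace.toDual_symm_apply]
  rw [(hasFDerivAt_entropy hy).fderiv, EuclideanSpace.inner_single_right] at h
  simpa [Pi.single_apply] using h

theorem bregman_eq (x : E d) {y : E d} (hy : y ∈ zone d) :
    bregman x y = ∑ i, (x i * Real.log (x i) - x i * Real.log (y i) - x i + y i) := by
  simp only [bregman, entropy, PiLp.inner_apply, gradient_entropy hy]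
  rw [← Finset.sum_sub_distrib, ← Finset.sum_sub_distrib]
  refine Finset.sum_congr rfl fun i _ => ?_
  simp
  ring

/-- The Bregman divergence of `t ↦ t log t` dominates the squared Hellinger distance. -/
theorem sq_sqrt_sub_sqrt_le {x y : ℝ} (hx : 0 ≤ x) (hy : 0 < y) :
    (√x - √y) ^ 2 ≤ x * Real.log x - x * Real.log y - x + y := by
  rcases hx.eq_or_lt with rfl | hx
  · simp [Real.sq_sqrt hy.le]
  have h := Real.log_le_sub_one_of_pos (div_pos (Real.sqrt_pos.2 hy) (Real.sqrt_pos.2 hx))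
  rw [Real.log_div (Real.sqrt_pos.2 hy).ne' (Real.sqrt_pos.2 hx).ne', Real.log_sqrt hx.le,
    Real.log_sqrt hy.le] at h
  have h2 := mul_le_mul_of_nonneg_left h hx.le
  have h3 : x * (√y / √x - 1) = √x * √y - x := by
    have := Real.sq_sqrt hx.le
    have h0 := (Real.sqrt_pos.2 hx).ne'
    field_simp
    linear_combination -√y * this
  rw [h3] at h2
  nlinarith [Real.sq_sqrt hx.le, Real.sq_sqrt hy.le]

/-- A Pinsker inequality valid for vectors of mass at most one: factor `x - y` as `(√x - √y) * (√x +
√y)` in each coordinate and apply Cauchy–Schwarz. The first factor is a Hellinger distance; the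
second contributes at most `2 * ∑ x + 2 * ∑ y ≤ 4`. -/
theorem sq_sum_abs_le_bregman {x y : E d} (hx : x ∈ simplex d) (hy : y ∈ simplex d ∩ zone d) :
    (∑ i, |x i - y i|) ^ 2 ≤ 4 * bregman x y := by
  have h1 : ∀ i, |x i - y i| = |√(x i) - √(y i)| * (√(x i) + √(y i)) := by
    intro i
    rw [← abs_of_nonneg (add_nonneg (Real.sqrt_nonneg (x i)) (Real.sqrt_nonneg (y i))), ← abs_mul]
    congr 1
    nlinarith [Real.sq_sqrt (hx.2 i), Real.sq_sqrt (hy.2 i).le]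
  have h2 := Finset.sum_mul_sq_le_sq_mul_sq Finset.univ (fun i => |√(x i) - √(y i)|)
    (fun i => √(x i) + √(y i))
  simp only [← h1, sq_abs] at h2
  refine h2.trans ?_
  have h3 : ∑ i, (√(x i) - √(y i)) ^ 2 ≤ bregman x y := by
    rw [bregman_eq x hy.2]
    exact Finset.sum_le_sum fun i _ => sq_sqrt_sub_sqrt_le (hx.2 i) (hy.2 i)
  have h4 : ∑ i, (√(x i) + √(y i)) ^ 2 ≤ 4 := by
    calc ∑ i, (√(x i) + √(y i)) ^ 2 ≤ ∑ i, (2 * x i + 2 * y i) := by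
          refine Finset.sum_le_sum fun i _ => ?_
          nlinarith [Real.sq_sqrt (hx.2 i), Real.sq_sqrt (hy.2 i).le, sq_nonneg (√(x i) - √(y i))]
      _ ≤ 4 := by
          rw [Finset.sum_add_distrib, ← Finset.mul_sum, ← Finset.mul_sum]
          linarith [hx.1, hy.1.1]
  have h5 : 0 ≤ ∑ i, (√(x i) - √(y i)) ^ 2 := Finset.sum_nonneg fun i _ => sq_nonneg _
  nlinarith

theorem bregman_nonneg {x y : E d} (hx : x ∈ simplex d) (hy : y ∈ simplex d ∩ zone d) :
    0 ≤ bregman x y := by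
  nlinarith [sq_sum_abs_le_bregman hx hy, sq_nonneg (∑ i, |x i - y i|)]

theorem continuous_entropy : Continuous (entropy (d := d)) := by
  unfold entropy
  exact continuous_finsetSum _ fun i _ => Real.continuous_mul_log.comp
    (EuclideanSpace.proj i : E d →L[ℝ] ℝ).continuous

theorem continuous_bregman (x : E d) : Continuous fun y : E d => bregman y x := by
  unfold bregman
  have := continuous_entropy (d := d)
  fun_prop

/-! ### The simplex and the mirror descent step -/

theorem convex_simplex : Convex ℝ (simplex d) := by
  intro x hx y hy a b ha hb hab
  refine ⟨?_, fun i => ?_⟩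
  · simp only [PiLp.add_apply, PiLp.smul_apply, smul_eq_mul, Finset.sum_add_distrib,
      ← Finset.mul_sum]
    nlinarith [hx.1, hy.1]
  · have := hx.2 i
    have := hy.2 i
    simp only [PiLp.add_apply, PiLp.smul_apply, smul_eq_mul]
    positivity

theorem convex_zone : Convex ℝ (zone d) := by
  intro x hx y hy a b ha hb hab i
  have := hx i
  have := hy i
  simp only [PiLp.add_apply, PiLp.smul_apply, smul_eq_mul]
  rcases ha.eq_or_lt with rfl | ha
  · simp_all
  · positivity

theorem isCompact_simplex : IsCompact (simplex d) := by
  refine Metric.isCompact_of_isClosed_isBounded ?_ ?_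
  · have h : simplex d = {x : E d | ∑ i, x i ≤ 1} ∩ ⋂ i, {x : E d | 0 ≤ x i} := by
      ext x; simp [simplex]
    rw [h]
    refine IsClosed.inter (isClosed_le (by fun_prop) (by fun_prop)) (isClosed_iInter fun i =>
      isClosed_le (by fun_prop) (by fun_prop))
  · refine (Metric.isBounded_closedBall (x := (0 : E d)) (r := 1)).subset fun x hx => ?_
    rw [mem_closedBall_zero_iff, EuclideanSpace.norm_eq, Real.sqrt_le_one]
    calc ∑ i, ‖x i‖ ^ 2 ≤ ∑ i, x i := by
          refine Finset.sum_le_sum fun i _ => ?_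
          have h1 : x i ≤ 1 :=
            (Finset.single_le_sum (fun j _ => hx.2 j) (Finset.mem_univ i)).trans hx.1
          rw [Real.norm_eq_abs, sq_abs]
          nlinarith [hx.2 i]
      _ ≤ 1 := hx.1

/-- The objective of the mirror descent step. -/
noncomputable def mdObj (r : E d → ℝ) (η : ℝ) (x g y : E d) : ℝ := η * (inner ℝ g y + r y) + bregman y x

theorem continuous_mdObj {r : E d → ℝ} (hr : ConvexOn ℝ univ r) (η : ℝ) (x g : E d) :
    Continuous (mdObj r η x g) := by
  have h : Continuous r := continuousOn_univ.1 (hr.continuousOn isOpen_univ)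
  have := continuous_bregman x
  unfold mdObj
  fun_prop

theorem mdStep_spec {r : E d → ℝ} (hr : ConvexOn ℝ univ r) (η : ℝ) {x : E d}
    (hx : x ∈ simplex d) (g : E d) :
    mdStep r η x g ∈ simplex d ∧
      ∀ y ∈ simplex d, mdObj r η x g (mdStep r η x g) ≤ mdObj r η x g y := by
  obtain ⟨z, hz, hmin⟩ := isCompact_simplex.exists_isMinOn ⟨x, hx⟩
    (continuous_mdObj hr η x g).continuousOn
  have h := Classical.epsilon_spec (p := fun z : E d => z ∈ simplex d ∧
    IsMinOn (fun y : E d => η * (inner ℝ g y + r y) + bregman y x) (simplex d) z) ⟨z, hz, hmin⟩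
  exact ⟨h.1, fun y hy => h.2 hy⟩

/-- The linear-plus-regularizer part of the mirror descent objective is convex. -/
theorem linear_add_le {r : E d → ℝ} (hr : ConvexOn ℝ univ r) {η : ℝ} (hη : 0 ≤ η) (g y z : E d)
    {t : ℝ} (ht0 : 0 ≤ t) (ht1 : t ≤ 1) :
    η * (inner ℝ g ((1 - t) • z + t • y) + r ((1 - t) • z + t • y)) ≤
      (1 - t) * (η * (inner ℝ g z + r z)) + t * (η * (inner ℝ g y + r y)) := by
  have h := hr.2 (mem_univ z) (mem_univ y) (sub_nonneg.2 ht1) ht0 (by ring)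
  simp only [smul_eq_mul] at h
  rw [inner_add_right, inner_smul_right, inner_smul_right]
  nlinarith

/-- Convexity along the segment from `z` to `x`, sharpened at a vanishing coordinate of `z`. The
extra `t * log t` beats any linear term as `t → 0`, which keeps minimizers off the boundary. -/
theorem bregman_segment_le {x z : E d} (hx : x ∈ zone d) (hz : z ∈ simplex d) {i : Fin d}
    (hi : z i = 0) {t : ℝ} (ht0 : 0 < t) (ht1 : t ≤ 1) :
    bregman ((1 - t) • z + t • x) x ≤ (1 - t) * bregman z x + t * x i * Real.log t := by
  rw [bregman_eq _ hx, bregman_eq _ hx, Finset.mul_sum, ← sub_le_iff_le_add',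
    ← Finset.sum_sub_distrib]
  refine (Finset.sum_le_sum (g := fun j => if j = i then t * x i * Real.log t else 0)
    fun j _ => ?_).trans (by simp)
  simp only [PiLp.add_apply, PiLp.smul_apply, smul_eq_mul]
  have hxj := hx j
  split_ifs with h
  · subst h
    rw [hi, mul_zero, zero_add, Real.log_mul ht0.ne' hxj.ne']
    apply le_of_eq; ring
  · have h1 := Real.convexOn_mul_log.2 (hz.2 j) hxj.le (sub_nonneg.2 ht1) ht0.le (by ring)
    simp only [smul_eq_mul] at h1
    nlinarith

theorem mdStep_mem {r : E d → ℝ} (hr : ConvexOn ℝ univ r) {η : ℝ} (hη : 0 ≤ η) {x : E d}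
    (hx : x ∈ simplex d ∩ zone d) (g : E d) : mdStep r η x g ∈ simplex d ∩ zone d := by
  obtain ⟨hz, hmin⟩ := mdStep_spec hr η hx.1 g
  refine ⟨hz, fun i => lt_of_le_of_ne (hz.2 i) fun hi => ?_⟩
  set z := mdStep r η x g
  -- If `z i = 0`, moving from `z` towards `x` changes the objective by at most a multiple of `t`
  -- plus `t * x i * log t`. Dividing by `t` leaves a bound that tends to `-∞`.
  have key : ∀ t : ℝ, 0 < t → t ≤ 1 →
      mdObj r η x g z ≤ η * (inner ℝ g x + r x) + x i * Real.log t := by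
    intro t ht0 ht1
    have h1 := hmin _ (convex_simplex hz hx.1 (sub_nonneg.2 ht1) ht0.le (by ring))
    have h2 := linear_add_le hr hη g x z ht0.le ht1
    have h3 := bregman_segment_le hx.2 hz hi.symm ht0 ht1
    unfold mdObj at h1 ⊢
    have h4 : t * (η * (inner ℝ g z + r z) + bregman z x) ≤
        t * (η * (inner ℝ g x + r x) + x i * Real.log t) := by nlinarith
    exact le_of_mul_le_mul_left h4 ht0
  set A := η * (inner ℝ g x + r x) - mdObj r η x g z
  have hA : 0 ≤ A := by
    have := key 1 one_pos le_rfl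
    simp only [Real.log_one, mul_zero, add_zero] at this
    exact sub_nonneg.2 this
  have hxi := hx.2 i
  -- This `t` makes `x i * log t` equal to `-(A + 1)`, one more than the available gap.
  have h := key (Real.exp (-((A + 1) / x i))) (Real.exp_pos _)
    (Real.exp_le_one_iff.2 (by rw [neg_nonpos]; positivity))
  rw [Real.log_exp, mul_neg, mul_div_cancel₀ _ hxi.ne'] at h
  simp only [A] at h
  linarith

theorem hasDerivAt_bregman_line (x : E d) {y z : E d} (hz : z ∈ zone d) :
    HasDerivAt (fun t : ℝ => bregman ((1 - t) • z + t • y) x)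
      (inner ℝ (gradient (entropy (d := d)) z - gradient (entropy (d := d)) x) (y - z)) 0 := by
  have hline : HasDerivAt (fun t : ℝ => (1 - t) • z + t • y) (y - z) 0 := by
    have h1 : HasDerivAt (fun t : ℝ => z + t • (y - z)) (y - z) 0 := by
      simpa using ((hasDerivAt_id (0 : ℝ)).smul_const (y - z)).const_add z
    refine h1.congr_of_eventuallyEq (Filter.Eventually.of_forall fun t => ?_)
    simp only [sub_smul, one_smul, smul_sub]
    abel
  have h0 : (1 - (0 : ℝ)) • z + (0 : ℝ) • y = z := by simp
  have he : HasDerivAt (fun t : ℝ => entropy ((1 - t) • z + t • y))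
      (fderiv ℝ (entropy (d := d)) z (y - z)) 0 := by
    refine HasFDerivAt.comp_hasDerivAt (l := entropy (d := d)) (0 : ℝ) ?_ hline
    rw [h0]
    exact (hasFDerivAt_entropy hz).differentiableAt.hasFDerivAt
  have hi : HasDerivAt
      (fun t : ℝ => inner ℝ (gradient (entropy (d := d)) x) ((1 - t) • z + t • y - x))
      (inner ℝ (gradient (entropy (d := d)) x) (y - z)) 0 := by
    have := (hasDerivAt_const (0 : ℝ) (gradient (entropy (d := d)) x)).inner ℝ (hline.sub_const x)
    simpa using this
  have := (he.sub_const (entropy x)).sub hi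
  rw [inner_sub_left, gradient, InnerProductSpace.toDual_symm_apply]
  exact this

theorem inner_gradient_entropy_sub (x y z : E d) :
    inner ℝ (gradient (entropy (d := d)) z - gradient (entropy (d := d)) x) (y - z) =
      bregman y x - bregman y z - bregman z x := by
  have : y - x = (y - z) + (z - x) := by abel
  unfold bregman
  rw [this, inner_add_right, inner_sub_left]
  ring

/-- The three-point inequality of mirror descent. -/
theorem mdStep_three_point {r : E d → ℝ} (hr : ConvexOn ℝ univ r) {η : ℝ} (hη : 0 ≤ η) {x : E d}
    (hx : x ∈ simplex d ∩ zone d) (g : E d) {y : E d} (hy : y ∈ simplex d) :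
    mdObj r η x g (mdStep r η x g) + bregman y (mdStep r η x g) ≤ mdObj r η x g y := by
  obtain ⟨hz, hmin⟩ := mdStep_spec hr η hx.1 g
  have hzz := (mdStep_mem hr hη hx g).2
  set z := mdStep r η x g
  have hder := (hasDerivAt_bregman_line x (y := y) hzz)
  rw [inner_gradient_entropy_sub] at hder
  have hlim := hder.hasDerivWithinAt (s := Ioi (0 : ℝ))
  rw [hasDerivWithinAt_iff_tendsto_slope' (by simp)] at hlim
  -- First-order optimality along the segment from `z` to `y`. As `r` need not be differentiable,
  -- only the Bregman part is differentiated; the rest is bounded by convexity for each `t` before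
  -- passing to the limit.
  have hge : η * (inner ℝ g z + r z) - η * (inner ℝ g y + r y) ≤
      bregman y x - bregman y z - bregman z x := by
    refine ge_of_tendsto hlim ?_
    filter_upwards [Ioc_mem_nhdsGT (zero_lt_one' ℝ)] with t ht
    have h1 := hmin _ (convex_simplex hz hy (sub_nonneg.2 ht.2) ht.1.le (by ring))
    have h2 := linear_add_le hr hη g y z ht.1.le ht.2
    unfold mdObj at h1
    rw [slope_def_field, le_div_iff₀ (by linarith [ht.1])]
    simp only [sub_zero, one_smul, zero_smul, add_zero]
    nlinarith
  unfold mdObj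
  linarith

theorem norm_le_sum_abs (x : E d) : ‖x‖ ≤ ∑ i, |x i| := by
  rw [EuclideanSpace.norm_eq]
  refine Real.sqrt_le_iff.2 ⟨Finset.sum_nonneg fun i _ => abs_nonneg _, ?_⟩
  simpa using Finset.sum_sq_le_sq_sum_of_nonneg (s := Finset.univ) (f := fun i => |x i|)
    fun i _ => abs_nonneg _

/-- Each minimizer is tested in the three-point inequality of the other. The sum bounds `bregman z
z' + bregman z' z` by an inner product of dual differences with `z - z'`, and strong convexity
finishes. This stability yields continuity of the step even though `mdStep` is defined by choice. -/
theorem dist_mdStep_le {r : E d → ℝ} (hr : ConvexOn ℝ univ r) {η : ℝ} (hη : 0 ≤ η) {x x' : E d}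
    (hx : x ∈ simplex d ∩ zone d) (hx' : x' ∈ simplex d ∩ zone d) (g g' : E d) :
    dist (mdStep r η x g) (mdStep r η x' g') ≤
      2 * dist (gradient (entropy (d := d)) x - η • g)
        (gradient (entropy (d := d)) x' - η • g') := by
  have hz := mdStep_mem hr hη hx g
  have hz' := mdStep_mem hr hη hx' g'
  have h1 := mdStep_three_point hr hη hx g hz'.1
  have h2 := mdStep_three_point hr hη hx' g' hz.1
  set z := mdStep r η x g
  set z' := mdStep r η x' g'
  have h3 := sq_sum_abs_le_bregman hz.1 hz'
  have h4 := sq_sum_abs_le_bregman hz'.1 hz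
  have h5 : ‖z - z'‖ ≤ ∑ i, |z i - z' i| := by simpa using norm_le_sum_abs (z - z')
  have h6 : ∑ i, |z i - z' i| = ∑ i, |z' i - z i| :=
    Finset.sum_congr rfl fun i _ => abs_sub_comm _ _
  rw [← h6] at h4
  set s := ∑ i, |z i - z' i|
  rw [dist_eq_norm, dist_eq_norm]
  set w := gradient (entropy (d := d)) x - η • g -
    (gradient (entropy (d := d)) x' - η • g')
  have h7 : s ^ 2 ≤ 2 * inner ℝ w (z - z') := by
    have e : inner ℝ w (z - z') =
        inner ℝ (gradient (entropy (d := d)) x) z - inner ℝ (gradient (entropy (d := d)) x) z'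
        - (inner ℝ (gradient (entropy (d := d)) x') z -
          inner ℝ (gradient (entropy (d := d)) x') z')
        - η * (inner ℝ g z - inner ℝ g z' - (inner ℝ g' z - inner ℝ g' z')) := by
      simp only [w, inner_sub_left, inner_sub_right, inner_smul_left]
      simp
      ring
    rw [e]
    unfold mdObj at h1 h2
    have b1 : ∀ u v : E d, bregman u v = entropy u - entropy v -
        (inner ℝ (gradient (entropy (d := d)) v) u -
          inner ℝ (gradient (entropy (d := d)) v) v) := fun u v => by
      rw [bregman, inner_sub_right]
    have k1 : bregman z' x - bregman z x - (bregman z' x' - bregman z x') =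
      inner ℝ (gradient (entropy (d := d)) x) z - inner ℝ (gradient (entropy (d := d)) x) z'
        - (inner ℝ (gradient (entropy (d := d)) x') z -
          inner ℝ (gradient (entropy (d := d)) x') z') := by
      simp only [b1]; ring
    nlinarith
  have h8 := real_inner_le_norm w (z - z')
  have h9 : ‖z - z'‖ ^ 2 ≤ s ^ 2 := pow_le_pow_left₀ (norm_nonneg _) h5 2
  rcases (norm_nonneg (z - z')).eq_or_lt with h0 | h0
  · rw [← h0]; positivity
  · refine le_of_mul_le_mul_right ?_ h0
    nlinarith

/-! ### Pathwise descent estimate -/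

theorem inner_le_norm_mul_sum_abs (b : Fin d → ℝ) (w : E d) :
    inner ℝ (WithLp.toLp 2 b) w ≤ ‖b‖ * ∑ i, |w i| := by
  rw [PiLp.inner_apply, Finset.mul_sum]
  refine Finset.sum_le_sum fun i _ => ?_
  simp only [RCLike.inner_apply, conj_trivial]
  calc w i * b i ≤ |b i| * |w i| := by rw [mul_comm, ← abs_mul]; exact le_abs_self _
    _ ≤ ‖b‖ * |w i| := mul_le_mul_of_nonneg_right (norm_le_pi_norm b i) (abs_nonneg _)

/-- One noisy mirror descent step decreases the objective by at least the envelope, up to the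
squared sup-norm of the noise. -/
theorem bfbe_le_step {F r : E d → ℝ} (hr : ConvexOn ℝ univ r) {l : ℝ} (hl : 0 < l)
    (hF : RelSmooth l F) {x : E d} (hx : x ∈ simplex d ∩ zone d) (b : Fin d → ℝ) :
    bfbe F r (5 * l) x ≤ 10 * l * ((F x + r x) -
      (F (mdStep r (1 / (2 * l)) x (grad F x + WithLp.toLp 2 b)) +
        r (mdStep r (1 / (2 * l)) x (grad F x + WithLp.toLp 2 b)))) + 5 * ‖b‖ ^ 2 := by
  have hη : (0 : ℝ) ≤ 1 / (2 * l) := by positivity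
  have hz := mdStep_mem hr hη hx (grad F x + WithLp.toLp 2 b)
  have h3 := fun y hy => mdStep_three_point hr hη hx (grad F x + WithLp.toLp 2 b) (y := y) hy
  set z := mdStep r (1 / (2 * l)) x (grad F x + WithLp.toLp 2 b)
  have key : (F z + r z) - (F x + r x) - ‖b‖ ^ 2 / (2 * l) ≤
      sInf ((fun y : E d => inner ℝ (grad F x) (y - x) + 5 * l * bregman y x + r y - r x) ''
        simplex d) := by
    refine le_csInf ⟨_, mem_image_of_mem _ hx.1⟩ ?_
    rintro _ ⟨y, hy, rfl⟩
    have h := mul_le_mul_of_nonneg_left (h3 y hy) (by positivity : (0 : ℝ) ≤ 2 * l)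
    have e1 : 2 * l * (mdObj r (1 / (2 * l)) x (grad F x + WithLp.toLp 2 b) z + bregman y z) =
        inner ℝ (grad F x) z + inner ℝ (WithLp.toLp 2 b) z + r z + 2 * l * bregman z x +
          2 * l * bregman y z := by
      unfold mdObj; rw [inner_add_left]; field_simp
    have e2 : 2 * l * mdObj r (1 / (2 * l)) x (grad F x + WithLp.toLp 2 b) y =
        inner ℝ (grad F x) y + inner ℝ (WithLp.toLp 2 b) y + r y + 2 * l * bregman y x := by
      unfold mdObj; rw [inner_add_left]; field_simp
    rw [e1, e2] at h
    have hs := (hF.2 z hz x hx).2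
    have hb := inner_le_norm_mul_sum_abs b (y - z)
    have hp := sq_sum_abs_le_bregman hy hz
    have hxy := bregman_nonneg hy hx
    have hzx := bregman_nonneg hz.1 hx
    simp only [PiLp.sub_apply] at hb
    set s := ∑ i, |y i - z i|
    -- Young's inequality weighted so that, by `s ^ 2 ≤ 4 * bregman y z`, the quadratic term is
    -- exactly the spare `2 * l * bregman y z` of the three-point inequality.
    have hbs : ‖b‖ * s ≤ ‖b‖ ^ 2 / (2 * l) + 2 * l * bregman y z := by
      have h1 : ‖b‖ ^ 2 / (2 * l) + l / 2 * s ^ 2 - ‖b‖ * s = (‖b‖ - l * s) ^ 2 / (2 * l) := by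
        field_simp; ring
      have h2 : 0 ≤ (‖b‖ - l * s) ^ 2 / (2 * l) := by positivity
      nlinarith
    beta_reduce
    rw [inner_sub_right] at hb hs ⊢
    -- The step produces only `2 * l * bregman y x`; the coefficient `5 * l` of the envelope leaves
    -- slack.
    nlinarith [mul_nonneg hl.le hxy, mul_nonneg hl.le hzx]
  unfold bfbe
  have := mul_le_mul_of_nonneg_left key (by positivity : (0 : ℝ) ≤ 10 * l)
  have e : 10 * l * ((F z + r z) - (F x + r x) - ‖b‖ ^ 2 / (2 * l)) =
      10 * l * ((F z + r z) - (F x + r x)) - 5 * ‖b‖ ^ 2 := by field_simp; ring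
  rw [e] at this
  linarith

theorem iter_mem {F r : E d → ℝ} (hr : ConvexOn ℝ univ r) {η : ℝ} (hη : 0 ≤ η) {x₀ : E d}
    (hx : x₀ ∈ simplex d ∩ zone d) (b : ℕ → Fin d → ℝ) (t : ℕ) :
    iter F r η x₀ b t ∈ simplex d ∩ zone d := by
  induction t with
  | zero => exact hx
  | succ t ih => exact mdStep_mem hr hη ih _

theorem le_gap {F r : E d → ℝ} (hbdd : BddBelow ((fun x => F x + r x) '' simplex d)) {x₀ x : E d}
    (hx : x ∈ simplex d) : (F x₀ + r x₀) - (F x + r x) ≤ gap F r x₀ :=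
  sub_le_sub_left (csInf_le hbdd (mem_image_of_mem (fun x => F x + r x) hx)) _

theorem gap_nonneg {F r : E d → ℝ} (hbdd : BddBelow ((fun x => F x + r x) '' simplex d))
    {x₀ : E d} (hx : x₀ ∈ simplex d) : 0 ≤ gap F r x₀ := by
  simpa using le_gap hbdd (x₀ := x₀) hx

/-- One step with zero noise. This handles `T = 1`, where no noise enters the average. -/
theorem bfbe_le_gap {F r : E d → ℝ} (hr : ConvexOn ℝ univ r) {l : ℝ} (hl : 0 < l)
    (hF : RelSmooth l F) (hbdd : BddBelow ((fun x => F x + r x) '' simplex d)) {x : E d}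
    (hx : x ∈ simplex d ∩ zone d) : bfbe F r (5 * l) x ≤ 10 * l * gap F r x := by
  have h := bfbe_le_step hr hl hF hx 0
  have hz := mdStep_mem hr (by positivity : (0 : ℝ) ≤ 1 / (2 * l)) hx
    (grad F x + WithLp.toLp 2 (0 : Fin d → ℝ))
  simp only [norm_zero] at h
  have := mul_le_mul_of_nonneg_left (le_gap hbdd (x₀ := x) hz.1) (by positivity : 0 ≤ 10 * l)
  linarith

theorem sum_bfbe_le {F r : E d → ℝ} (hr : ConvexOn ℝ univ r) {l : ℝ} (hl : 0 < l)
    (hF : RelSmooth l F) (hbdd : BddBelow ((fun x => F x + r x) '' simplex d)) {x₀ : E d}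
    (hx : x₀ ∈ simplex d ∩ zone d) (b : ℕ → Fin d → ℝ) (T : ℕ) :
    ∑ t ∈ Finset.range T, bfbe F r (5 * l) (iter F r (1 / (2 * l)) x₀ b t) ≤
      10 * l * gap F r x₀ + 5 * ∑ t ∈ Finset.range T, ‖b t‖ ^ 2 := by
  have hη : (0 : ℝ) ≤ 1 / (2 * l) := by positivity
  have h : ∑ t ∈ Finset.range T, bfbe F r (5 * l) (iter F r (1 / (2 * l)) x₀ b t) ≤
      10 * l * ((F x₀ + r x₀) - (F (iter F r (1 / (2 * l)) x₀ b T) +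
        r (iter F r (1 / (2 * l)) x₀ b T))) + 5 * ∑ t ∈ Finset.range T, ‖b t‖ ^ 2 := by
    induction T with
    | zero => simp [iter]
    | succ T ih =>
      rw [Finset.sum_range_succ, Finset.sum_range_succ]
      have := bfbe_le_step hr hl hF (iter_mem (F := F) hr hη hx b T) (b T)
      rw [iter]
      linarith
  have := mul_le_mul_of_nonneg_left (le_gap hbdd (x₀ := x₀) (iter_mem (F := F) hr hη hx b T).1)
    (by positivity : 0 ≤ 10 * l)
  linarith

/-! ### The gradient on the relatively open simplex -/

theorem inner_grad (F : E d → ℝ) (x v : E d) :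
    inner ℝ (grad F x) v = fderivWithin ℝ F (simplex d ∩ zone d) x v := by
  rw [grad, gradientWithin, InnerProductSpace.toDual_symm_apply]

/-- A point of the interior of `simplex d ∩ zone d`. -/
noncomputable def basePoint (d : ℕ) : E d := WithLp.toLp 2 fun _ => 1 / (2 * d)

theorem basePoint_add_mem {w : E d} (hd : 0 < d) (hw : ∀ i, |w i| < 1 / (2 * d)) :
    basePoint d + w ∈ simplex d ∩ zone d := by
  have hd' : (0 : ℝ) < d := by exact_mod_cast hd
  have h : ∀ i, 0 < (basePoint d + w) i := fun i => by
    simp only [basePoint, PiLp.add_apply]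
    linarith [neg_abs_le (w i), hw i]
  refine ⟨⟨?_, fun i => (h i).le⟩, h⟩
  calc ∑ i, (basePoint d + w) i ≤ ∑ _i : Fin d, (1 / (d : ℝ)) := by
        refine Finset.sum_le_sum fun i _ => ?_
        simp only [basePoint, PiLp.add_apply]
        have : (1 : ℝ) / d = 1 / (2 * d) + 1 / (2 * d) := by field_simp; ring
        linarith [le_abs_self (w i), hw i]
    _ ≤ 1 := by simp; field_simp; rfl

theorem uniqueDiffOn_simplex_zone (hd : 0 < d) : UniqueDiffOn ℝ (simplex d ∩ zone d) := by
  refine uniqueDiffOn_convex (convex_simplex.inter convex_zone) ⟨basePoint d, ?_⟩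
  rw [mem_interior_iff_mem_nhds, Metric.mem_nhds_iff]
  refine ⟨1 / (2 * d), by positivity, fun y hy => ?_⟩
  rw [← add_sub_cancel (basePoint d) y]
  refine basePoint_add_mem hd fun i => ?_
  rw [mem_ball_iff_norm] at hy
  exact (PiLp.norm_apply_le (y - basePoint d) i).trans_lt hy

theorem grad_empLoss {Ξ : Type*} {n : ℕ} {f : E d → Ξ → ℝ} (hd : 0 < d)
    (hf : ∀ ξ, DifferentiableOn ℝ (fun x => f x ξ) (simplex d ∩ zone d)) (S : Fin n → Ξ) {x : E d}
    (hx : x ∈ simplex d ∩ zone d) :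
    grad (empLoss f S) x = ∑ i, grad (fun y => f y (S i)) x := by
  refine ext_inner_right ℝ fun v => ?_
  rw [sum_inner, inner_grad]
  simp only [inner_grad]
  have : empLoss f S = fun y => ∑ i, f y (S i) := rfl
  rw [this, fderivWithin_fun_sum (uniqueDiffOn_simplex_zone hd x hx) fun i _ => hf (S i) x hx]
  simp

/-- A bound on all empirical gradients bounds their sensitivity. -/
theorem norm_grad_sub_le {Ξ : Type*} {n : ℕ} {f : E d → Ξ → ℝ} (hd : 0 < d) (hn : 0 < n)
    (hf : ∀ ξ, DifferentiableOn ℝ (fun x => f x ξ) (simplex d ∩ zone d)) {G : ℝ}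
    (hG : ∀ S : Fin n → Ξ, ∀ x ∈ simplex d ∩ zone d, ‖grad (empLoss f S) x‖ ≤ G)
    {S S' : Fin n → Ξ} (h : Neighbors S S') {x : E d} (hx : x ∈ simplex d ∩ zone d) :
    ‖grad (empLoss f S) x - grad (empLoss f S') x‖ ≤ 2 * G / n := by
  have hn' : (0 : ℝ) < n := by exact_mod_cast hn
  have h1 : ∀ ξ, ‖grad (fun y => f y ξ) x‖ ≤ G / n := by
    intro ξ
    -- On the constant dataset the empirical gradient is `n` times that of a single loss, so each
    -- loss has gradient at most `G / n`.
    have := hG (fun _ => ξ) x hx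
    rw [grad_empLoss hd hf _ hx, Finset.sum_const, Finset.card_univ, Fintype.card_fin,
      ← Nat.cast_smul_eq_nsmul ℝ, norm_smul, Real.norm_natCast] at this
    rwa [le_div_iff₀' hn']
  obtain ⟨i, -, hi⟩ := h
  rw [grad_empLoss hd hf _ hx, grad_empLoss hd hf _ hx, ← Finset.sum_sub_distrib,
    Finset.sum_eq_single i (fun j _ hj => by rw [hi j hj, sub_self])
      (fun h => absurd (Finset.mem_univ i) h)]
  calc _ ≤ G / n + G / n := (norm_sub_le _ _).trans (add_le_add (h1 _) (h1 _))
    _ = _ := by ring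

/-! ### Measurability of the iterates in the noise -/

/-- The gradient need not be continuous, but its pairing with `p - x` is a pointwise limit of
difference quotients continuous in `x`. Aiming at a fixed `p` keeps the increments inside the convex
set. -/
theorem measurable_inner_grad {F : E d → ℝ} (hF : DifferentiableOn ℝ F (simplex d ∩ zone d))
    {p : E d} (hp : p ∈ simplex d ∩ zone d) :
    Measurable fun x : ↥(simplex d ∩ zone d) => inner ℝ (grad F x) (p - (x : E d)) := by
  have hmem : ∀ (m : ℕ) (x : ↥(simplex d ∩ zone d)),
      (x : E d) + ((m : ℝ) + 1)⁻¹ • (p - (x : E d)) ∈ simplex d ∩ zone d := by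
    intro m x
    exact (convex_simplex.inter convex_zone).add_smul_sub_mem x.2 hp
      ⟨by positivity, inv_le_one_of_one_le₀ (by linarith [Nat.cast_nonneg (α := ℝ) m])⟩
  refine measurable_of_tendsto_metrizable (f := fun (m : ℕ)
    (x : ↥(simplex d ∩ zone d)) =>
    ((m : ℝ) + 1) * (F ((x : E d) + ((m : ℝ) + 1)⁻¹ • (p - (x : E d))) - F x)) (fun m => ?_) ?_
  · have h1 : Continuous fun x : ↥(simplex d ∩ zone d) => F x :=
      continuousOn_iff_continuous_domRestrict.1 hF.continuousOn
    have h2 : Continuous fun x : ↥(simplex d ∩ zone d) =>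
        F ((x : E d) + ((m : ℝ) + 1)⁻¹ • (p - (x : E d))) :=
      h1.comp (f := fun x => (⟨_, hmem m x⟩ : ↥(simplex d ∩ zone d)))
        (Continuous.subtype_mk (by fun_prop) _)
    exact (continuous_const.mul (h2.sub h1)).measurable
  · rw [tendsto_pi_nhds]
    intro x
    rw [inner_grad]
    have h0 : Filter.Tendsto (fun m : ℕ => ((m : ℝ) + 1)⁻¹) Filter.atTop (nhds 0) := by
      simpa [one_div] using tendsto_one_div_add_atTop_nhds_zero_nat (𝕜 := ℝ)
    refine (hF x x.2).hasFDerivWithinAt.lim (c := fun m : ℕ => (m : ℝ) + 1)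
      (d := fun m : ℕ => ((m : ℝ) + 1)⁻¹ • (p - (x : E d))) ?_
      (Filter.Eventually.of_forall fun m => hmem m x) ?_
    · simpa using h0.smul_const (p - (x : E d))
    · refine tendsto_const_nhds.congr fun m => ?_
      rw [smul_smul, mul_inv_cancel₀ (by positivity), one_smul]

theorem measurable_grad (hd : 0 < d) {F : E d → ℝ}
    (hF : DifferentiableOn ℝ F (simplex d ∩ zone d)) :
    Measurable fun x : ↥(simplex d ∩ zone d) => grad F x := by
  have hd' : (0 : ℝ) < d := by exact_mod_cast hd
  have h : ∀ i : Fin d, Measurable fun x : ↥(simplex d ∩ zone d) => grad F x i := by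
    intro i
    have h0 : basePoint d ∈ simplex d ∩ zone d := by
      simpa using basePoint_add_mem (w := 0) hd (fun i => by simp; omega)
    have h1 : basePoint d + EuclideanSpace.single i (1 / (4 * d) : ℝ) ∈ simplex d ∩ zone d := by
      refine basePoint_add_mem hd fun j => ?_
      have h4 : (1 : ℝ) / (4 * d) < 1 / (2 * d) :=
        one_div_lt_one_div_of_lt (by positivity) (by linarith)
      by_cases hj : j = i
      · subst hj
        simp only [PiLp.single_apply, if_true]
        rwa [abs_of_pos (by positivity)]
      · simp [hj, hd]
    -- The two target points differ by a multiple of a basis vector, so `x` cancels and one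
    -- coordinate of the gradient remains.
    have h2 := ((measurable_inner_grad hF h1).sub (measurable_inner_grad hF h0)).const_mul (4 * d : ℝ)
    convert h2 using 2 with x
    simp only [Pi.sub_apply]
    rw [← inner_sub_right, sub_sub_sub_cancel_right, add_sub_cancel_left,
      EuclideanSpace.inner_single_right]
    simp
    field_simp
  have h2 := (MeasurableEquiv.toLp 2 (Fin d → ℝ)).measurable.comp (measurable_pi_lambda _ h)
  exact h2

theorem continuousOn_gradient_entropy : ContinuousOn (gradient (entropy (d := d))) (zone d) := by
  have h : ContinuousOn (fun y : E d => WithLp.toLp 2 fun i => Real.log (y i) + 1) (zone d) := by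
    refine (PiLp.continuous_toLp 2 _).comp_continuousOn (continuousOn_pi.2 fun i => ?_)
    exact (ContinuousOn.log (by fun_prop) fun y hy => (hy i).ne').add continuousOn_const
  refine h.congr fun y hy => ?_
  ext i
  exact gradient_entropy hy i

theorem continuous_mdStep {r : E d → ℝ} (hr : ConvexOn ℝ univ r) {η : ℝ} (hη : 0 ≤ η) :
    Continuous fun p : ↥(simplex d ∩ zone d) × E d => mdStep r η (p.1 : E d) p.2 := by
  have hc : Continuous fun p : ↥(simplex d ∩ zone d) × E d =>
      gradient (entropy (d := d)) (p.1 : E d) - η • p.2 := by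
    have h1 : Continuous fun x : ↥(simplex d ∩ zone d) => gradient (entropy (d := d)) (x : E d) :=
      continuousOn_iff_continuous_domRestrict.1
        (continuousOn_gradient_entropy.mono inter_subset_right)
    exact (h1.comp continuous_fst).sub (continuous_snd.const_smul η)
  rw [continuous_iff_continuousAt]
  intro q
  rw [ContinuousAt, tendsto_iff_dist_tendsto_zero]
  have hq := ((tendsto_iff_dist_tendsto_zero.1 hc.continuousAt.tendsto).const_mul 2 :
    Filter.Tendsto _ (nhds q) _)
  rw [mul_zero] at hq
  exact squeeze_zero (fun _ => dist_nonneg)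
    (fun p => dist_mdStep_le hr hη p.1.2 q.1.2 p.2 q.2) hq

theorem measurable_iter (hd : 0 < d) {F r : E d → ℝ}
    (hF : DifferentiableOn ℝ F (simplex d ∩ zone d)) (hr : ConvexOn ℝ univ r) {η : ℝ}
    (hη : 0 ≤ η) {x₀ : E d} (hx : x₀ ∈ simplex d ∩ zone d) (t : ℕ) :
    Measurable fun b : ℕ → Fin d → ℝ =>
      (⟨iter F r η x₀ b t, iter_mem hr hη hx b t⟩ : ↥(simplex d ∩ zone d)) := by
  refine Measurable.subtype_mk ?_
  induction t with
  | zero => exact measurable_const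
  | succ t ih =>
    have h1 : Measurable fun b : ℕ → Fin d → ℝ =>
        (⟨iter F r η x₀ b t, iter_mem hr hη hx b t⟩ : ↥(simplex d ∩ zone d)) := ih.subtype_mk
    have h2 := (measurable_grad hd hF).comp h1
    have h3 : Measurable fun b : ℕ → Fin d → ℝ => (WithLp.toLp 2 (b t) : E d) :=
      (MeasurableEquiv.toLp 2 (Fin d → ℝ)).measurable.comp (measurable_pi_apply t)
    have hm := (continuous_mdStep (d := d) hr hη).measurable
    have h4 : Measurable fun b : ℕ → Fin d → ℝ =>
        ((⟨iter F r η x₀ b t, iter_mem hr hη hx b t⟩ : ↥(simplex d ∩ zone d)),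
          grad F (iter F r η x₀ b t) + WithLp.toLp 2 (b t)) := h1.prodMk (h2.add h3)
    have h5 := hm.comp h4
    simp only [Function.comp_def] at h5
    simpa only [iter] using h5

/-! ### Resampling one coordinate of a product measure -/

section Resample

variable {ι : Type*} [DecidableEq ι] {X : ι → Type*} [∀ i, MeasurableSpace (X i)]
  (μ : (i : ι) → Measure (X i)) [∀ i, IsProbabilityMeasure (μ i)]

theorem measurable_update_prod (i : ι) :
    Measurable fun p : ((j : ι) → X j) × X i => Function.update p.1 i p.2 := by
  refine measurable_pi_lambda _ fun j => ?_
  by_cases h : j = i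
  · subst h; simpa using measurable_snd
  · simp only [Function.update_of_ne h]
    exact (measurable_pi_apply j).comp measurable_fst

/-- Resampling one coordinate does not change an infinite product measure. -/
theorem map_update_infinitePi (i : ι) :
    ((Measure.infinitePi μ).prod (μ i)).map (fun p => Function.update p.1 i p.2) =
      Measure.infinitePi μ := by
  refine Measure.eq_infinitePi μ fun s t ht => ?_
  rw [Measure.map_apply (measurable_update_prod i)
    (MeasurableSet.pi s.countable_toSet fun j _ => ht j)]
  by_cases hi : i ∈ s
  · have : (fun p : ((j : ι) → X j) × X i => Function.update p.1 i p.2) ⁻¹' ((s : Set ι).pi t) =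
        (((s.erase i : Finset ι) : Set ι).pi t) ×ˢ t i := by
      ext p
      simp only [mem_preimage, Set.mem_pi, mem_prod, Finset.mem_coe, Finset.mem_erase]
      constructor
      · intro h
        refine ⟨fun j hj => ?_, by simpa using h i hi⟩
        simpa [Function.update_of_ne hj.1] using h j hj.2
      · rintro ⟨h1, h2⟩ j hj
        by_cases hji : j = i
        · subst hji; simpa using h2
        · simpa [Function.update_of_ne hji] using h1 j ⟨hji, hj⟩
    rw [this, Measure.prod_prod, Measure.infinitePi_pi μ fun j _ => ht j,
      Finset.prod_erase_mul _ _ hi]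
  · have : (fun p : ((j : ι) → X j) × X i => Function.update p.1 i p.2) ⁻¹' ((s : Set ι).pi t) =
        ((s : Set ι).pi t) ×ˢ univ := by
      ext p
      simp only [mem_preimage, Set.mem_pi, mem_prod, mem_univ, and_true, Finset.mem_coe]
      refine forall₂_congr fun j hj => ?_
      rw [Function.update_of_ne (by rintro rfl; exact hi hj)]
    rw [this, Measure.prod_prod, measure_univ, mul_one, Measure.infinitePi_pi μ fun j _ => ht j]

/-- Fubini in a single coordinate without splitting the index set; the inductions over coordinates
and over time rest on it. -/
theorem lintegral_infinitePi_update (i : ι) {g : ((j : ι) → X j) → ℝ≥0∞} (hg : Measurable g) :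
    ∫⁻ b, g b ∂Measure.infinitePi μ =
      ∫⁻ b, ∫⁻ y, g (Function.update b i y) ∂μ i ∂Measure.infinitePi μ := by
  conv_lhs => rw [← map_update_infinitePi μ i, lintegral_map hg (measurable_update_prod i)]
  exact lintegral_prod _ (hg.comp (measurable_update_prod i)).aemeasurable

theorem measurable_lintegral_update (i : ι) {g : ((j : ι) → X j) → ℝ≥0∞} (hg : Measurable g) :
    Measurable fun b => ∫⁻ y, g (Function.update b i y) ∂μ i :=
  (hg.comp (measurable_update_prod i)).lintegral_prod_right'

end Resample

/-! ### Gaussian translations and their composition -/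

/-- Translates of `μ` by `u` satisfy a Hölder-type (Harnack) inequality with constant `K`. -/
def ShiftBound {V : Type*} [MeasurableSpace V] [Add V] (μ : Measure V) (p : ℝ) (u : V)
    (K : ℝ≥0∞) : Prop :=
  ∀ φ : V → ℝ≥0∞, Measurable φ → ∫⁻ b, φ (b + u) ∂μ ≤ K * (∫⁻ b, φ b ^ p ∂μ) ^ (1 / p)

theorem lintegral_exp_mul_gaussianReal {v : ℝ≥0} (s : ℝ) :
    ∫⁻ x, ENNReal.ofReal (Real.exp (s * x)) ∂gaussianReal 0 v =
      ENNReal.ofReal (Real.exp (v * s ^ 2 / 2)) := by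
  have h := mgf_gaussianReal (p := gaussianReal 0 v) (X := id) (μ := 0) (v := v)
    (Measure.map_id) s
  rw [← ofReal_integral_eq_lintegral_ofReal]
  · rw [mgf] at h
    simp only [id] at h
    rw [h]; simp
  · exact integrable_exp_mul_gaussianReal s
  · exact Filter.Eventually.of_forall fun x => (Real.exp_pos _).le

/-- The Cameron–Martin density of a translated Gaussian. -/
theorem lintegral_add_gaussianReal {v : ℝ≥0} (hv : v ≠ 0) (u : ℝ) {φ : ℝ → ℝ≥0∞}
    (hφ : Measurable φ) :
    ∫⁻ b, φ (b + u) ∂gaussianReal 0 v =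
      ∫⁻ b, ENNReal.ofReal (Real.exp (u / v * b - u ^ 2 / (2 * v))) * φ b ∂gaussianReal 0 v := by
  rw [← lintegral_map (f := φ) (g := fun b => b + u) hφ (by fun_prop),
    gaussianReal_map_add_const, gaussianReal_of_var_ne_zero _ hv, gaussianReal_of_var_ne_zero _ hv,
    lintegral_withDensity_eq_lintegral_mul _ (measurable_gaussianPDF _ _) hφ,
    lintegral_withDensity_eq_lintegral_mul _ (measurable_gaussianPDF _ _) (by fun_prop)]
  refine lintegral_congr fun b => ?_
  simp only [Pi.mul_apply]
  rw [← mul_assoc]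
  congr 1
  rw [gaussianPDF, gaussianPDF, ← ENNReal.ofReal_mul (gaussianPDFReal_nonneg _ _ _)]
  congr 1
  rw [gaussianPDFReal, gaussianPDFReal, mul_assoc _ (Real.exp _),
    ← Real.exp_add]
  congr 2
  have : (v : ℝ) ≠ 0 := by exact_mod_cast hv
  field_simp
  ring

/-- Hölder's inequality against the Cameron–Martin density, whose `L^q` norm is the stated constant.
-/
theorem shiftBound_gaussianReal {v : ℝ≥0} (hv : v ≠ 0) (u : ℝ) {p q : ℝ}
    (hpq : q.HolderConjugate p) :
    ShiftBound (gaussianReal 0 v) p u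
      (ENNReal.ofReal (Real.exp ((q - 1) * u ^ 2 / (2 * v)))) := by
  intro φ hφ
  rw [lintegral_add_gaussianReal hv u hφ]
  refine (ENNReal.lintegral_mul_le_Lp_mul_Lq _ hpq
    (f := fun b => ENNReal.ofReal (Real.exp (u / v * b - u ^ 2 / (2 * v)))) (g := φ)
    (by fun_prop) hφ.aemeasurable).trans (le_of_eq ?_)
  congr 1
  have hq := hpq.pos
  have hv' : (v : ℝ) ≠ 0 := by exact_mod_cast hv
  have : ∀ b : ℝ, ENNReal.ofReal (Real.exp (u / v * b - u ^ 2 / (2 * v))) ^ q =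
      ENNReal.ofReal (Real.exp (-(q * u ^ 2 / (2 * v)))) *
        ENNReal.ofReal (Real.exp (q * u / v * b)) := by
    intro b
    rw [ENNReal.ofReal_rpow_of_pos (Real.exp_pos _), ← Real.exp_mul,
      ← ENNReal.ofReal_mul (Real.exp_pos _).le, ← Real.exp_add]
    congr 2
    ring
  simp_rw [this]
  rw [lintegral_const_mul _ (by fun_prop), lintegral_exp_mul_gaussianReal,
    ← ENNReal.ofReal_mul (Real.exp_pos _).le, ← Real.exp_add,
    ENNReal.ofReal_rpow_of_pos (Real.exp_pos _), ← Real.exp_mul]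
  congr 2
  field_simp
  ring

section Composition

variable {ι : Type*} [DecidableEq ι] {V : Type*} [MeasurableSpace V] {p : ℝ}

/-- Taking the `L^p` norm in one coordinate first does not change the total `L^p` norm; hence the
constants multiply under composition. -/
theorem lintegral_rpow_lintegral_update (μ : ι → Measure V) [∀ i, IsProbabilityMeasure (μ i)]
    (hp : 0 < p) (i : ι) {φ : (ι → V) → ℝ≥0∞} (hφ : Measurable φ) :
    ∫⁻ b, ((∫⁻ y, φ (Function.update b i y) ^ p ∂μ i) ^ (1 / p)) ^ p ∂Measure.infinitePi μ =
      ∫⁻ b, φ b ^ p ∂Measure.infinitePi μ := by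
  rw [lintegral_infinitePi_update μ i (hφ.pow_const p)]
  refine lintegral_congr fun b => ?_
  rw [← ENNReal.rpow_mul, one_div_mul_cancel hp.ne', ENNReal.rpow_one]

theorem ShiftBound.infinitePi_finset [AddZeroClass V] [MeasurableAdd₂ V] {μ : ι → Measure V}
    [∀ i, IsProbabilityMeasure (μ i)] (hp : 1 < p) {u : ι → V} {K : ι → ℝ≥0∞}
    (h : ∀ i, ShiftBound (μ i) p (u i) (K i)) (s : Finset ι) :
    ShiftBound (Measure.infinitePi μ) p (fun i => if i ∈ s then u i else 0) (∏ i ∈ s, K i) := by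
  induction s using Finset.induction_on with
  | empty =>
    intro φ hφ
    have h0 : ∀ b : ι → V, b + (fun i => if i ∈ (∅ : Finset ι) then u i else 0) = b := fun b => by
      ext i; simp
    simp only [h0, Finset.prod_empty, one_mul]
    have := eLpNorm_le_eLpNorm_of_exponent_le (μ := Measure.infinitePi μ) (p := 1)
      (q := ENNReal.ofReal p) (f := φ) (by simpa using hp.le) hφ.aestronglyMeasurable
    rw [eLpNorm_one_eq_lintegral_enorm, eLpNorm_eq_lintegral_rpow_enorm_toReal
      (by simp; linarith) (by simp), ENNReal.toReal_ofReal (by linarith)] at this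
    simpa using this
  | insert i s hi ih =>
    intro φ hφ
    have hm : Measurable fun b : ι → V => b + fun j => if j ∈ insert i s then u j else 0 :=
      measurable_pi_lambda _ fun j => (measurable_pi_apply j).add measurable_const
    rw [lintegral_infinitePi_update μ i
      (g := fun b => φ (b + fun j => if j ∈ insert i s then u j else 0)) (hφ.comp hm)]
    set w : ι → V := fun j => if j ∈ s then u j else 0
    have hupd : ∀ (b : ι → V) (y : V),
        (Function.update b i y + fun j => if j ∈ insert i s then u j else 0) =
          Function.update (b + w) i (y + u i) := by
      intro b y
      ext j
      by_cases hj : j = i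
      · subst hj; simp
      · simp [w, hj]
    simp only [hupd]
    set ψ : (ι → V) → ℝ≥0∞ := fun c => (∫⁻ y, φ (Function.update c i y) ^ p ∂μ i) ^ (1 / p)
    have hψ : Measurable ψ :=
      (measurable_lintegral_update μ i (hφ.pow_const p)).pow_const _
    calc ∫⁻ b, ∫⁻ y, φ (Function.update (b + w) i (y + u i)) ∂μ i ∂Measure.infinitePi μ
        ≤ ∫⁻ b, K i * ψ (b + w) ∂Measure.infinitePi μ := by
          refine lintegral_mono fun b => ?_
          exact h i (fun y => φ (Function.update (b + w) i y))
            (hφ.comp (measurable_update (b + w)))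
      _ = K i * ∫⁻ b, ψ (b + w) ∂Measure.infinitePi μ :=
          lintegral_const_mul _ (hψ.comp
            (measurable_pi_lambda _ fun j => (measurable_pi_apply j).add measurable_const))
      _ ≤ K i * ((∏ i ∈ s, K i) * (∫⁻ b, ψ b ^ p ∂Measure.infinitePi μ) ^ (1 / p)) := by
          gcongr
          exact ih ψ hψ
      _ = _ := by
          rw [lintegral_rpow_lintegral_update μ (by linarith) i hφ, Finset.prod_insert hi,
            mul_assoc]

/-- Composition of adaptive shifts: in step `t` the noise is translated by `w t`, which may depend
on the noise of the earlier steps. -/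
theorem lintegral_adaptive_shift_le [Add V] (μ : Measure V) [IsProbabilityMeasure μ] (hp : 0 < p)
    {w : ℕ → (ℕ → V) → V} (hw : ∀ t b b', (∀ s < t, b s = b' s) → w t b = w t b') {K : ℝ≥0∞}
    (h : ∀ t b, ShiftBound μ p (w t b) K) (hθ : Measurable fun (b : ℕ → V) t => b t + w t b) (T : ℕ)
    {φ : (ℕ → V) → ℝ≥0∞} (hφ : Measurable φ) (hφT : ∀ b b', (∀ s < T, b s = b' s) → φ b = φ b') :
    ∫⁻ b, φ (fun t => b t + w t b) ∂Measure.infinitePi (fun _ => μ) ≤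
      K ^ T * (∫⁻ b, φ b ^ p ∂Measure.infinitePi (fun _ => μ)) ^ (1 / p) := by
  set P := Measure.infinitePi (fun _ : ℕ => μ)
  set θ : (ℕ → V) → ℕ → V := fun b t => b t + w t b
  induction T generalizing φ with
  | zero =>
    have hV : Nonempty V := by
      by_contra hV
      rw [not_nonempty_iff] at hV
      have := measure_univ (μ := μ)
      rw [univ_eq_empty_iff.2 hV, measure_empty] at this
      exact zero_ne_one this
    obtain ⟨b₀⟩ : Nonempty (ℕ → V) := inferInstance
    have : ∀ b, φ b = φ b₀ := fun b => hφT b b₀ (by simp)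
    simp only [this, pow_zero, one_mul, lintegral_const, measure_univ, mul_one]
    rw [← ENNReal.rpow_mul, mul_one_div_cancel hp.ne', ENNReal.rpow_one]
  | succ T ih =>
    set ψ : (ℕ → V) → ℝ≥0∞ := fun c => (∫⁻ y, φ (Function.update c T y) ^ p ∂μ) ^ (1 / p)
    have hψ : Measurable ψ :=
      (measurable_lintegral_update (fun _ : ℕ => μ) T (hφ.pow_const p)).pow_const _
    -- The two arguments agree only up to time `T`: later shifts may depend on the resampled `y`,
    -- but `φ` does not see them.
    have hupd : ∀ b y, φ (θ (Function.update b T y)) =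
        φ (Function.update (θ b) T (y + w T b)) := by
      intro b y
      refine hφT _ _ fun s hs => ?_
      have hagree : ∀ s ≤ T, w s (Function.update b T y) = w s b := fun s hs =>
        hw s _ _ fun j hj => Function.update_of_ne (by omega) _ _
      simp only [θ]
      rw [hagree s (by omega)]
      by_cases hsT : s = T
      · subst hsT; simp
      · simp [Function.update_of_ne hsT]
    calc ∫⁻ b, φ (θ b) ∂P = ∫⁻ b, ∫⁻ y, φ (θ (Function.update b T y)) ∂μ ∂P :=
          lintegral_infinitePi_update (fun _ => μ) T (hφ.comp hθ)
      _ = ∫⁻ b, ∫⁻ y, φ (Function.update (θ b) T (y + w T b)) ∂μ ∂P := by simp only [hupd]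
      _ ≤ ∫⁻ b, K * ψ (θ b) ∂P := by
          refine lintegral_mono fun b => ?_
          exact h T b (fun y => φ (Function.update (θ b) T y))
            (hφ.comp (measurable_update (θ b)))
      _ = K * ∫⁻ b, ψ (θ b) ∂P := lintegral_const_mul _ (hψ.comp hθ)
      _ ≤ K * (K ^ T * (∫⁻ b, ψ b ^ p ∂P) ^ (1 / p)) := by
          gcongr
          refine ih hψ fun b b' hbb => ?_
          simp only [ψ]
          congr 1
          refine lintegral_congr fun y => ?_
          rw [hφT _ (Function.update b' T y) fun s hs => ?_]
          by_cases hsT : s = T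
          · subst hsT; simp
          · simp [Function.update_of_ne hsT, hbb s (by omega)]
      _ = _ := by
          rw [lintegral_rpow_lintegral_update (fun _ => μ) hp T hφ, pow_succ', mul_assoc]

end Composition

theorem shiftBound_pi_gaussianReal {v : ℝ≥0} (hv : v ≠ 0) (u : Fin d → ℝ) {p q : ℝ}
    (hpq : q.HolderConjugate p) {Δ : ℝ} (hu : ∑ i, u i ^ 2 ≤ Δ ^ 2) :
    ShiftBound (Measure.pi fun _ : Fin d => gaussianReal 0 v) p u
      (ENNReal.ofReal (Real.exp ((q - 1) * Δ ^ 2 / (2 * v)))) := by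
  intro φ hφ
  have h := ShiftBound.infinitePi_finset (μ := fun _ : Fin d => gaussianReal 0 v) hpq.symm.lt
    (u := u) (fun i => shiftBound_gaussianReal hv (u i) hpq) Finset.univ φ hφ
  simp only [Finset.mem_univ, if_true, Measure.infinitePi_eq_pi] at h
  refine h.trans ?_
  gcongr
  rw [← ENNReal.ofReal_prod_of_nonneg fun i _ => (Real.exp_pos _).le, ← Real.exp_sum,
    ← Finset.sum_div, ← Finset.mul_sum]
  have := hpq.lt
  gcongr

/-- A Hölder-type comparison of probabilities yields an `(ε, δ)`-type comparison. -/
theorem le_exp_mul_add_of_rpow {P Q : ℝ≥0∞} {p q κ ε δ : ℝ} (hpq : q.HolderConjugate p)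
    (h : P ≤ ENNReal.ofReal (Real.exp κ) * Q ^ (1 / p))
    (hδ : Real.exp (q * κ - ε * (q - 1)) ≤ δ) :
    P ≤ ENNReal.ofReal (Real.exp ε) * Q + ENNReal.ofReal δ := by
  have hp := hpq.symm.pos
  have hq := hpq.pos
  have hp1 := hpq.symm.lt
  have hq1 := hpq.lt
  -- The factor `exp (ε / p)` is moved onto `Q`, so that the `p`-th power in Young's inequality
  -- gives exactly `exp ε * Q`.
  have hy := ENNReal.young_inequality (ENNReal.ofReal (Real.exp (κ - ε / p)))
    ((ENNReal.ofReal (Real.exp ε) * Q) ^ (1 / p)) hpq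
  have e1 : ENNReal.ofReal (Real.exp (κ - ε / p)) * (ENNReal.ofReal (Real.exp ε) * Q) ^ (1 / p) =
      ENNReal.ofReal (Real.exp κ) * Q ^ (1 / p) := by
    rw [ENNReal.mul_rpow_of_nonneg _ _ (by positivity),
      ENNReal.ofReal_rpow_of_pos (Real.exp_pos _), ← Real.exp_mul, ← mul_assoc,
      ← ENNReal.ofReal_mul (Real.exp_pos _).le, ← Real.exp_add]
    congr 3
    ring
  have e2 : ENNReal.ofReal (Real.exp (κ - ε / p)) ^ q =
      ENNReal.ofReal (Real.exp (q * κ - ε * (q - 1))) := by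
    rw [ENNReal.ofReal_rpow_of_pos (Real.exp_pos _), ← Real.exp_mul]
    congr 2
    have : q - 1 = q / p := by rw [eq_div_iff hp.ne', hpq.sub_one_mul_conj]
    rw [this]
    ring
  have e3 : ((ENNReal.ofReal (Real.exp ε) * Q) ^ (1 / p)) ^ p = ENNReal.ofReal (Real.exp ε) * Q := by
    rw [← ENNReal.rpow_mul, one_div_mul_cancel hp.ne', ENNReal.rpow_one]
  rw [e1, e2, e3] at hy
  have hdiv : ∀ (a : ℝ≥0∞) {s : ℝ}, 1 < s → a / ENNReal.ofReal s ≤ a := fun a s hs =>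
    ENNReal.div_le_of_le_mul (le_mul_of_one_le_right (by simp) (by simpa using hs.le))
  calc P ≤ _ := h
    _ ≤ _ := hy
    _ ≤ ENNReal.ofReal δ + ENNReal.ofReal (Real.exp ε) * Q :=
        add_le_add ((hdiv _ hq1).trans (ENNReal.ofReal_le_ofReal hδ)) (hdiv _ hp1)
    _ = _ := add_comm _ _

/-! ### Concentration of the sup-norm of the noise -/

/-- The rate `1 / (4 * v)` is half the critical one, so the variance of the weighted Gaussian
doubles, hence `√2`. -/
theorem lintegral_exp_sq_gaussianReal {v : ℝ≥0} (hv : v ≠ 0) :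
    ∫⁻ x, ENNReal.ofReal (Real.exp (x ^ 2 / (4 * v))) ∂gaussianReal 0 v = ENNReal.ofReal √2 := by
  have hv' : (0 : ℝ) < v := by exact_mod_cast pos_iff_ne_zero.2 hv
  rw [gaussianReal_of_var_ne_zero _ hv,
    lintegral_withDensity_eq_lintegral_mul _ (measurable_gaussianPDF _ _) (by fun_prop)]
  have : ∀ x : ℝ, (gaussianPDF 0 v * fun x => ENNReal.ofReal (Real.exp (x ^ 2 / (4 * v)))) x =
      ENNReal.ofReal ((√(2 * Real.pi * v))⁻¹ * Real.exp (-(1 / (4 * v)) * x ^ 2)) := by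
    intro x
    simp only [Pi.mul_apply]
    rw [gaussianPDF, ← ENNReal.ofReal_mul (gaussianPDFReal_nonneg _ _ _), gaussianPDFReal,
      mul_assoc _ (Real.exp _), ← Real.exp_add]
    congr 3
    field_simp
    ring
  simp only [this]
  rw [← ofReal_integral_eq_lintegral_ofReal
    ((integrable_exp_neg_mul_sq (by positivity)).const_mul _)
    (Filter.Eventually.of_forall fun x => by positivity), integral_const_mul, integral_gaussian]
  congr 1
  rw [← Real.sqrt_inv, ← Real.sqrt_mul (by positivity)]
  congr 1
  field_simp
  norm_num

/-- The exponential of the maximum is at most the sum of the exponentials, which costs a factor `d`,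
a logarithm later. -/
theorem lintegral_exp_norm_sq_le (hd : 0 < d) {v : ℝ≥0} (hv : v ≠ 0) :
    ∫⁻ b, ENNReal.ofReal (Real.exp (‖b‖ ^ 2 / (4 * v))) ∂(Measure.pi fun _ : Fin d =>
      gaussianReal 0 v) ≤ ENNReal.ofReal (d * √2) := by
  have : Nonempty (Fin d) := ⟨⟨0, hd⟩⟩
  calc _ ≤ ∫⁻ b, ∑ i, ENNReal.ofReal (Real.exp ((b i) ^ 2 / (4 * v)))
        ∂(Measure.pi fun _ : Fin d => gaussianReal 0 v) := by
        refine lintegral_mono fun b => ?_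
        obtain ⟨i, hi⟩ : ∃ i, ‖b‖ ≤ ‖b i‖ := by
          by_contra! h
          exact lt_irrefl _ ((pi_norm_lt_iff ((norm_nonneg (b ⟨0, hd⟩)).trans_lt (h _))).2 h)
        have hi2 : ‖b‖ ^ 2 ≤ (b i) ^ 2 := by
          rw [← sq_abs (b i), ← Real.norm_eq_abs]
          exact pow_le_pow_left₀ (norm_nonneg _) hi 2
        refine (ENNReal.ofReal_le_ofReal (Real.exp_le_exp.2
          (div_le_div_of_nonneg_right hi2 (by positivity)))).trans ?_
        exact Finset.single_le_sum (f := fun i => ENNReal.ofReal (Real.exp ((b i) ^ 2 / (4 * v))))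
          (fun _ _ => zero_le) (Finset.mem_univ i)
    _ = ∑ _i : Fin d, ENNReal.ofReal √2 := by
        rw [lintegral_finsetSum _ fun i _ => by fun_prop]
        refine Finset.sum_congr rfl fun i _ => ?_
        rw [← lintegral_exp_sq_gaussianReal hv]
        exact (measurePreserving_eval (fun _ : Fin d => gaussianReal 0 v) i).lintegral_comp
          (f := fun x => ENNReal.ofReal (Real.exp (x ^ 2 / (4 * v)))) (by fun_prop)
    _ = _ := by
        rw [Finset.sum_const, Finset.card_univ, Fintype.card_fin, nsmul_eq_mul,
          ENNReal.ofReal_mul (by positivity), ENNReal.ofReal_natCast]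

theorem lintegral_prod_infinitePi {V : Type*} [MeasurableSpace V] (μ : Measure V)
    [IsProbabilityMeasure μ] {g : V → ℝ≥0∞} (hg : Measurable g) (T : ℕ) :
    ∫⁻ b, ∏ t ∈ Finset.range T, g (b t) ∂Measure.infinitePi (fun _ : ℕ => μ) =
      (∫⁻ y, g y ∂μ) ^ T := by
  induction T with
  | zero => simp
  | succ T ih =>
    rw [lintegral_infinitePi_update (fun _ => μ) T (by fun_prop)]
    have : ∀ (b : ℕ → V) (y : V), ∏ t ∈ Finset.range (T + 1), g (Function.update b T y t) =
        (∏ t ∈ Finset.range T, g (b t)) * g y := by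
      intro b y
      rw [Finset.prod_range_succ, Function.update_self]
      congr 1
      refine Finset.prod_congr rfl fun t ht => ?_
      rw [Function.update_of_ne (Finset.mem_range.1 ht).ne]
    simp only [this]
    simp_rw [lintegral_const_mul _ hg]
    rw [lintegral_mul_const _ (by fun_prop), ih, pow_succ]

theorem noise_sum_norm_sq_le (hd : 0 < d) {v : ℝ≥0} (hv : v ≠ 0) (T : ℕ) {β : ℝ}
    (hβ : 0 < β) :
    ENNReal.ofReal (1 - β) ≤ noise d v {b | ∑ t ∈ Finset.range T, ‖b t‖ ^ 2 ≤
      4 * v * (T * Real.log (d * √2) + Real.log (1 / β))} := by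
  have hv' : (0 : ℝ) < v := by exact_mod_cast pos_iff_ne_zero.2 hv
  have hd' : (0 : ℝ) < d := by exact_mod_cast hd
  have : IsProbabilityMeasure (noise d v) := by unfold noise; infer_instance
  set g : (Fin d → ℝ) → ℝ≥0∞ := fun y => ENNReal.ofReal (Real.exp (‖y‖ ^ 2 / (4 * v)))
  have hg : Measurable g := by fun_prop
  -- The Markov threshold: the bound on the exponential moment of the sum, divided by `β`.
  set M : ℝ := (d * √2) ^ T / β
  have hM : 0 < M := by positivity
  have hmeas : Measurable fun b : ℕ → Fin d → ℝ => ∏ t ∈ Finset.range T, g (b t) := by fun_prop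
  set B : Set (ℕ → Fin d → ℝ) := {b | ENNReal.ofReal M ≤ ∏ t ∈ Finset.range T, g (b t)}
  have hB : MeasurableSet B := measurableSet_le measurable_const hmeas
  have hPB : noise d v B ≤ ENNReal.ofReal β := by
    have h1 := mul_meas_ge_le_lintegral (μ := noise d v) hmeas (ENNReal.ofReal M)
    have h2 : ∫⁻ b, ∏ t ∈ Finset.range T, g (b t) ∂noise d v ≤
        ENNReal.ofReal M * ENNReal.ofReal β := by
      unfold noise
      rw [lintegral_prod_infinitePi _ hg, ← ENNReal.ofReal_mul hM.le, div_mul_cancel₀ _ hβ.ne',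
        ENNReal.ofReal_pow (by positivity)]
      exact pow_le_pow_left' (lintegral_exp_norm_sq_le hd hv) T
    exact (ENNReal.mul_le_mul_iff_right (by simpa using hM) (by simp)).1 (h1.trans h2)
  calc ENNReal.ofReal (1 - β) = 1 - ENNReal.ofReal β := by
        rw [ENNReal.ofReal_sub _ hβ.le, ENNReal.ofReal_one]
    _ ≤ 1 - noise d v B := tsub_le_tsub_left hPB 1
    _ = noise d v Bᶜ := (prob_compl_eq_one_sub hB).symm
    _ ≤ _ := by
        refine measure_mono fun b hb => ?_
        simp only [B, mem_compl_iff, mem_ofPred_eq, not_le, g] at hb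
        rw [← ENNReal.ofReal_prod_of_nonneg fun i _ => (Real.exp_pos _).le, ← Real.exp_sum,
          ENNReal.ofReal_lt_ofReal_iff hM, ← Real.lt_log_iff_exp_lt hM, ← Finset.sum_div,
          div_lt_iff₀ (by positivity)] at hb
        rw [mem_ofPred_eq]
        refine hb.le.trans (le_of_eq ?_)
        rw [Real.log_div (by positivity) hβ.ne', Real.log_pow, one_div, Real.log_inv]
        ring

/-! ### Privacy of mirror descent -/

theorem iter_congr (F r : E d → ℝ) (η : ℝ) (x₀ : E d) {b b' : ℕ → Fin d → ℝ} {t : ℕ}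
    (h : ∀ s < t, b s = b' s) : iter F r η x₀ b t = iter F r η x₀ b' t := by
  induction t with
  | zero => rfl
  | succ t ih => rw [iter, iter, ih fun s hs => h s (by omega), h t (by omega)]

/-- Translating the noise by the difference of the gradients turns the iterates for one loss into
those for another. -/
theorem iter_shift (F F' r : E d → ℝ) (η : ℝ) (x₀ : E d) (b : ℕ → Fin d → ℝ) (t : ℕ) :
    iter F' r η x₀ (fun t => b t + (grad F (iter F r η x₀ b t) -
      grad F' (iter F r η x₀ b t)).ofLp) t = iter F r η x₀ b t := by
  induction t with
  | zero => rfl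
  | succ t ih =>
    rw [iter, ih, iter]
    congr 1
    rw [WithLp.toLp_add, WithLp.toLp_ofLp, add_left_comm, add_sub_cancel, add_comm]

theorem measurable_dpmd {Ξ : Type*} {n : ℕ} {f : E d → Ξ → ℝ} {r : E d → ℝ} (hd : 0 < d)
    (hr : ConvexOn ℝ univ r) {η : ℝ} (hη : 0 ≤ η) {x₀ : E d} (hx : x₀ ∈ simplex d ∩ zone d)
    (hf : ∀ ξ, DifferentiableOn ℝ (fun x => f x ξ) (simplex d ∩ zone d)) (T : ℕ) (S : Fin n → Ξ) :
    Measurable (dpmd f r η x₀ T S) := by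
  have hS : DifferentiableOn ℝ (empLoss f S) (simplex d ∩ zone d) :=
    DifferentiableOn.fun_sum fun i _ => hf (S i)
  exact measurable_pi_lambda _ fun t =>
    measurable_subtype_coe.comp (measurable_iter hd hS hr hη hx t)

theorem isDP_dpmd {Ξ : Type*} {n : ℕ} {f : E d → Ξ → ℝ} {r : E d → ℝ} (hd : 0 < d)
    (hr : ConvexOn ℝ univ r) {η : ℝ} (hη : 0 ≤ η) {x₀ : E d} (hx : x₀ ∈ simplex d ∩ zone d)
    (hf : ∀ ξ, DifferentiableOn ℝ (fun x => f x ξ) (simplex d ∩ zone d)) {Δ : ℝ}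
    (hΔ : ∀ S S' : Fin n → Ξ, Neighbors S S' → ∀ x ∈ simplex d ∩ zone d,
      ‖grad (empLoss f S) x - grad (empLoss f S') x‖ ≤ Δ)
    {v : ℝ≥0} (hv : v ≠ 0) {q ε δ : ℝ} (hq : 1 < q) (T : ℕ)
    (hδ : Real.exp (q * (T * ((q - 1) * Δ ^ 2 / (2 * v))) - ε * (q - 1)) ≤ δ) :
    IsDP (noise d v) (dpmd (n := n) f r η x₀ T) ε δ := by
  intro S S' hSS A hA
  have hpq : q.HolderConjugate (Real.conjExponent q) := Real.HolderConjugate.conjExponent hq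
  set p := Real.conjExponent q
  have hS : ∀ S : Fin n → Ξ, DifferentiableOn ℝ (empLoss f S) (simplex d ∩ zone d) := fun S =>
    DifferentiableOn.fun_sum fun i _ => hf (S i)
  set w : ℕ → (ℕ → Fin d → ℝ) → Fin d → ℝ := fun t b =>
    (grad (empLoss f S) (iter (empLoss f S) r η x₀ b t) -
      grad (empLoss f S') (iter (empLoss f S) r η x₀ b t)).ofLp
  have hB : MeasurableSet {b | dpmd f r η x₀ T S' b ∈ A} :=
    measurable_dpmd hd hr hη hx hf T S' hA
  set φ : (ℕ → Fin d → ℝ) → ℝ≥0∞ := indicator {b | dpmd f r η x₀ T S' b ∈ A} 1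
  have hφ : Measurable φ := measurable_one.indicator hB
  have hcomp : ∀ b, dpmd f r η x₀ T S' (fun t => b t + w t b) = dpmd f r η x₀ T S b := fun b =>
    funext fun t => iter_shift (empLoss f S) (empLoss f S') r η x₀ b t
  have hθ : Measurable fun (b : ℕ → Fin d → ℝ) t => b t + w t b := by
    refine measurable_pi_lambda _ fun t => (measurable_pi_apply t).add ?_
    have hi := measurable_iter hd (hS S) hr hη hx t
    exact (MeasurableEquiv.toLp 2 (Fin d → ℝ)).symm.measurable.comp
      (((measurable_grad hd (hS S)).comp hi).sub ((measurable_grad hd (hS S')).comp hi))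
  have hsb : ∀ t b, ShiftBound (Measure.pi fun _ : Fin d => gaussianReal 0 v) p (w t b)
      (ENNReal.ofReal (Real.exp ((q - 1) * Δ ^ 2 / (2 * v)))) := by
    intro t b
    refine shiftBound_pi_gaussianReal hv _ hpq ?_
    have h1 := hΔ S S' hSS _ (iter_mem (F := empLoss f S) hr hη hx b t)
    have h2 := pow_le_pow_left₀ (norm_nonneg _) h1 2
    rw [EuclideanSpace.norm_sq_eq] at h2
    simpa [w] using h2
  have key := lintegral_adaptive_shift_le (Measure.pi fun _ : Fin d => gaussianReal 0 v)
    hpq.symm.pos (w := w) (fun t b b' h => by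
      simp only [w]; rw [iter_congr (empLoss f S) r η x₀ h]) hsb hθ T hφ (fun b b' h => by
      have : dpmd f r η x₀ T S' b = dpmd f r η x₀ T S' b' := funext fun t =>
        iter_congr (empLoss f S') r η x₀ fun s hs => h s (by omega)
      exact indicator_eq_indicator (by rw [mem_ofPred_eq, mem_ofPred_eq, this]) rfl)
  have e1 : ∀ b, φ (fun t => b t + w t b) =
      indicator {b | dpmd f r η x₀ T S b ∈ A} (1 : (ℕ → Fin d → ℝ) → ℝ≥0∞) b := fun b => by
    exact indicator_eq_indicator (by rw [mem_ofPred_eq, mem_ofPred_eq, hcomp]) rfl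
  have e2 : ∀ b, φ b ^ p = φ b := fun b => by
    simp only [φ, indicator]
    split_ifs
    · simp
    · exact ENNReal.zero_rpow_of_pos hpq.symm.pos
  simp only [e1, e2] at key
  have hB' : MeasurableSet {b | dpmd f r η x₀ T S b ∈ A} :=
    measurable_dpmd hd hr hη hx hf T S hA
  rw [lintegral_indicator_one hB',
    lintegral_indicator_one hB, ← ENNReal.ofReal_pow (Real.exp_pos _).le, ← Real.exp_nat_mul] at key
  exact le_exp_mul_add_of_rpow hpq key hδ

/-! ### Choice of parameters and the main theorem -/

/-- The choice of the noise variance makes the Rényi-type privacy bound at most `δ`. -/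
theorem privacy_budget {c₁ G ε δ v : ℝ} {n T : ℕ} (hc₁ : 0 < c₁) (hn : 0 < n) (hT : 0 < T)
    (hG : 0 < G) (hδ : 0 < δ) (hδ1 : δ < 1) (hε : 0 < ε) (hεδ : ε ≤ c₁ * Real.log (1 / δ))
    (hv : v = (8 + 4 * c₁) * G ^ 2 * T * Real.log (1 / δ) / (n ^ 2 * ε ^ 2)) :
    Real.exp ((1 + 2 * Real.log (1 / δ) / ε) * (T * ((1 + 2 * Real.log (1 / δ) / ε - 1) *
      (2 * G / n) ^ 2 / (2 * v))) - ε * (1 + 2 * Real.log (1 / δ) / ε - 1)) ≤ δ := by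
  have hL : 0 < Real.log (1 / δ) := Real.log_pos (by rw [lt_div_iff₀ hδ]; linarith)
  have hδe : δ = Real.exp (-Real.log (1 / δ)) := by
    rw [one_div, Real.log_inv, neg_neg, Real.exp_log hδ]
  set L := Real.log (1 / δ)
  have hn' : (0 : ℝ) < n := by exact_mod_cast hn
  have hT' : (0 : ℝ) < T := by exact_mod_cast hT
  conv_rhs => rw [hδe]
  rw [Real.exp_le_exp, hv]
  -- The order is `1 + 2 * L / ε`, so the `ε`-term contributes `-2 * L`. The constant `8 + 4 * c₁`
  -- is what keeps the Rényi cost below `L` when `ε ≤ c₁ * L`.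
  have e : (1 + 2 * L / ε) * (T * ((1 + 2 * L / ε - 1) * (2 * G / n) ^ 2 /
      (2 * ((8 + 4 * c₁) * G ^ 2 * T * L / (n ^ 2 * ε ^ 2))))) - ε * (1 + 2 * L / ε - 1) =
      (8 * L + 4 * ε) / (8 + 4 * c₁) - 2 * L := by
    field_simp
    ring
  rw [e]
  have : (8 * L + 4 * ε) / (8 + 4 * c₁) ≤ L := by
    rw [div_le_iff₀ (by positivity)]
    nlinarith
  linarith

/-- The choice `T = ⌈√(lΛ)/Q⌉` balances the two error terms; for `T = 1` the noise plays no role. -/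
theorem average_bound {l Λ g Q A LdLb V X c₂ c₃ : ℝ} {T : ℕ} (hl : 0 < l) (hΛ : 0 < Λ)
    (hg : 0 ≤ g) (hQ : 0 < Q) (hc₂ : 0 < c₂) (hc₃ : 0 ≤ c₃) (hT : T = ⌈√(l * Λ) / Q⌉₊)
    (hone : T = 1 → A ≤ 10 * l * g) (hV : V * LdLb = c₂ * T * Q ^ 2)
    (hX : X ≤ V * LdLb * c₃) (hA : A ≤ 10 * l * g / T + 20 * X) :
    A ≤ (10 + 40 * c₂ * c₃) * (Q * √l) * (√Λ + g / √Λ) := by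
  have hsl := Real.sqrt_pos.2 hl
  have hsΛ := Real.sqrt_pos.2 hΛ
  have hll := Real.mul_self_sqrt hl.le
  have hsqrt : √(l * Λ) = √l * √Λ := Real.sqrt_mul hl.le _
  rw [hsqrt] at hT
  set s := √l
  set m := √Λ
  have hk : 0 ≤ c₂ * c₃ := by positivity
  have hgm : 0 ≤ g / m := by positivity
  have ha : 0 < s * m / Q := by positivity
  have hexp : (10 + 40 * c₂ * c₃) * (Q * s) * (m + g / m) = 10 * (Q * s) * (g / m) +
      40 * (c₂ * c₃) * (Q * s) * m + (10 * (Q * s) * m + 40 * (c₂ * c₃) * (Q * s) * (g / m)) := by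
    ring
  have hrest : 0 ≤ 10 * (Q * s) * m + 40 * (c₂ * c₃) * (Q * s) * (g / m) := by positivity
  have hlg : ∀ B : ℝ, s * m / Q ≤ B → 10 * l * g ≤ B * (10 * (Q * s) * (g / m)) := by
    intro B hB
    calc 10 * l * g = s * m / Q * (10 * (Q * s) * (g / m)) := by
          rw [← hll]; field_simp
      _ ≤ _ := mul_le_mul_of_nonneg_right hB (by positivity)
  -- Above `1` the ceiling at most doubles its argument, so both error terms are comparable to their
  -- balanced value. Below `1` the noise term may be too large, and `hone` replaces it.
  rcases le_or_gt (s * m / Q) 1 with h1 | h1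
  · have hT1 : T = 1 := by
      rw [hT]
      exact le_antisymm (Nat.ceil_le.2 (by simpa using h1)) (Nat.ceil_pos.2 ha)
    have h2 := hone hT1
    have h3 := hlg 1 h1
    have h4 : 0 ≤ 40 * (c₂ * c₃) * (Q * s) * m := by positivity
    linarith
  · have hTge : s * m / Q ≤ T := by rw [hT]; exact Nat.le_ceil _
    have hTle : (T : ℝ) ≤ 2 * (s * m / Q) := by
      rw [hT]
      linarith [Nat.ceil_lt_add_one ha.le]
    have hTpos : (0 : ℝ) < T := ha.trans_le hTge
    have h2 : 10 * l * g / T ≤ 10 * (Q * s) * (g / m) := by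
      rw [div_le_iff₀ hTpos, mul_comm]
      rw [mul_comm]
      linarith [hlg T hTge, mul_comm (T : ℝ) (10 * (Q * s) * (g / m))]
    have h3 : V * LdLb * c₃ ≤ 2 * (c₂ * c₃) * (Q * s) * m := by
      rw [hV]
      calc c₂ * T * Q ^ 2 * c₃ = T * (c₂ * c₃ * Q ^ 2) := by ring
        _ ≤ 2 * (s * m / Q) * (c₂ * c₃ * Q ^ 2) :=
          mul_le_mul_of_nonneg_right hTle (by positivity)
        _ = _ := by field_simp
    linarith

end DPMD

theorem corollary1 :
    ∀ c₁ : ℝ, 0 < c₁ → ∃ c₂ : ℝ, 0 < c₂ ∧ ∀ β₀ : ℝ, 0 < β₀ → β₀ < 1 → ∃ C : ℝ, 0 < C ∧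
    ∀ (Ξ : Type*) (d n : ℕ) (f : DPMD.E d → Ξ → ℝ) (r : DPMD.E d → ℝ) (x₀ : DPMD.E d)
      (l G ε δ β Λ : ℝ) (T : ℕ) (v : ℝ≥0),
      2 ≤ d → 0 < n → 0 < l → 0 < G → 0 < Λ →
      0 < δ → δ < 1 → 0 < ε → ε ≤ c₁ * Real.log (1 / δ) → 0 < β → β ≤ β₀ →
      ConvexOn ℝ univ r → x₀ ∈ DPMD.simplex d ∩ DPMD.zone d →
      (∀ ξ, DifferentiableOn ℝ (fun x => f x ξ) (DPMD.simplex d ∩ DPMD.zone d)) →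
      (∀ S : Fin n → Ξ, ∀ x ∈ DPMD.simplex d ∩ DPMD.zone d,
        ‖DPMD.grad (DPMD.empLoss f S) x‖ ≤ G) →
      T = ⌈n * ε * √(l * Λ) /
        (G * √(Real.log d * Real.log (1 / δ) * Real.log (1 / β)))⌉₊ →
      v = Real.toNNReal (c₂ * G ^ 2 * T * Real.log (1 / δ) / (n ^ 2 * ε ^ 2)) →
      -- privacy
      DPMD.IsDP (DPMD.noise d v) (DPMD.dpmd (n := n) f r (1 / (2 * l)) x₀ T) ε δ ∧
      -- utility
      ∀ S : Fin n → Ξ,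
        DPMD.RelSmooth l (DPMD.empLoss f S) →
        BddBelow ((fun x => DPMD.empLoss f S x + r x) '' DPMD.simplex d) →
        (DPMD.gap (DPMD.empLoss f S) r x₀ = Λ →
          ENNReal.ofReal (1 - β) ≤ DPMD.noise d v {b |
            (1 / (T : ℝ)) * ∑ t ∈ Finset.range T, DPMD.bfbe (DPMD.empLoss f S) r (5 * l)
                (DPMD.iter (DPMD.empLoss f S) r (1 / (2 * l)) x₀ b t) ≤
              C * (G * √(l * DPMD.gap (DPMD.empLoss f S) r x₀ * Real.log d *
                Real.log (1 / δ) * Real.log (1 / β)) / (n * ε))}) ∧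
        ENNReal.ofReal (1 - β) ≤ DPMD.noise d v {b |
          (1 / (T : ℝ)) * ∑ t ∈ Finset.range T, DPMD.bfbe (DPMD.empLoss f S) r (5 * l)
              (DPMD.iter (DPMD.empLoss f S) r (1 / (2 * l)) x₀ b t) ≤
            C * (G * √(l * Real.log d * Real.log (1 / δ) * Real.log (1 / β)) / (n * ε)) *
              (√Λ + DPMD.gap (DPMD.empLoss f S) r x₀ / √Λ)} := by
  intro c₁ hc₁
  refine ⟨8 + 4 * c₁, by positivity, fun β₀ hβ₀ hβ₀1 => ?_⟩
  set c₂ := 8 + 4 * c₁ with hc₂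
  have hc₂pos : 0 < c₂ := by positivity
  have hκ : 0 < Real.log (1 / β₀) := Real.log_pos (by rw [lt_div_iff₀ hβ₀]; linarith)
  set κ := Real.log (1 / β₀)
  -- Chosen to bound `3 / 2 * log d + log (1 / β)` by `c₃ * log d * log (1 / β)`, using `log (1 / β)
  -- ≥ κ` and `log d ≥ 1 / 2`. Keeping `β` away from `1` is essential for the first summand.
  set c₃ := 3 / (2 * κ) + 2 with hc₃
  have hc₃pos : 0 < c₃ := by positivity
  -- The factor `2` serves the case where `Λ` is the initial gap: there `√Λ + g / √Λ = 2 * √Λ`.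
  refine ⟨2 * (10 + 40 * c₂ * c₃), by positivity, ?_⟩
  intro Ξ d n f r x₀ l G ε δ β Λ T v hd hn hl hG hΛ hδ hδ1 hε hεδ hβ hββ₀ hr hx hf hgrad hT hv
  have hd0 : 0 < d := by omega
  have hd2 : (2 : ℝ) ≤ d := by exact_mod_cast hd
  have hn' : (0 : ℝ) < n := by exact_mod_cast hn
  have hL : 0 < Real.log (1 / δ) := Real.log_pos (by rw [lt_div_iff₀ hδ]; linarith)
  have hκβ : κ ≤ Real.log (1 / β) :=
    Real.log_le_log (by positivity) (one_div_le_one_div_of_le hβ hββ₀)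
  have hLb : 0 < Real.log (1 / β) := hκ.trans_le hκβ
  have hLd2 : 1 / 2 ≤ Real.log d :=
    (by linarith [Real.log_two_gt_d9] : (1 : ℝ) / 2 ≤ Real.log 2).trans
      (Real.log_le_log two_pos hd2)
  have hLd : 0 < Real.log d := by linarith
  have hlogd : Real.log (d * √2) ≤ 3 / 2 * Real.log d := by
    rw [Real.log_mul (by positivity) (by positivity), Real.log_sqrt two_pos.le]
    linarith [Real.log_le_log two_pos hd2]
  set L := Real.log (1 / δ)
  set Lb := Real.log (1 / β)
  set Ld := Real.log d
  have hR : 0 < √(Ld * L * Lb) := Real.sqrt_pos.2 (by positivity)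
  set Q := G * √(Ld * L * Lb) / (n * ε) with hQdef
  have hQ : 0 < Q := by positivity
  have hTQ : T = ⌈√(l * Λ) / Q⌉₊ := by
    rw [hT, hQdef]
    congr 1
    field_simp
  have hTpos : 0 < T := by
    rw [hTQ, Nat.ceil_pos]
    exact div_pos (Real.sqrt_pos.2 (by positivity)) hQ
  have hT' : (0 : ℝ) < T := by exact_mod_cast hTpos
  have hvpos : 0 < c₂ * G ^ 2 * T * L / (n ^ 2 * ε ^ 2) := by positivity
  have hveq : (v : ℝ) = c₂ * G ^ 2 * T * L / (n ^ 2 * ε ^ 2) := by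
    rw [hv, Real.coe_toNNReal _ hvpos.le]
  have hv0 : v ≠ 0 := by
    rw [hv]; exact (Real.toNNReal_pos.2 hvpos).ne'
  refine ⟨DPMD.isDP_dpmd hd0 hr (by positivity) hx hf
    (fun S S' h x hx => DPMD.norm_grad_sub_le hd0 hn hf hgrad h hx) hv0
    (q := 1 + 2 * L / ε) (by linarith [show 0 < 2 * L / ε by positivity]) T
    (DPMD.privacy_budget hc₁ hn hTpos hG hδ hδ1 hε hεδ hveq), fun S hS hbdd => ?_⟩
  set F := DPMD.empLoss f S
  set g := DPMD.gap F r x₀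
  have hg : 0 ≤ g := DPMD.gap_nonneg hbdd hx.1
  have main : ENNReal.ofReal (1 - β) ≤ DPMD.noise d v {b | (1 / (T : ℝ)) *
      ∑ t ∈ Finset.range T, DPMD.bfbe F r (5 * l) (DPMD.iter F r (1 / (2 * l)) x₀ b t) ≤
        (10 + 40 * c₂ * c₃) * (Q * √l) * (√Λ + g / √Λ)} := by
    -- The utility bound holds at every point of the noise event, so monotonicity suffices and
    -- `bfbe` need not be shown measurable.
    refine (DPMD.noise_sum_norm_sq_le hd0 hv0 T hβ).trans (measure_mono fun b hb => ?_)
    rw [mem_ofPred_eq] at hb ⊢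
    refine DPMD.average_bound (V := v) (LdLb := Ld * Lb) (X := v * (Ld * Lb) * c₃) hl hΛ hg hQ
      hc₂pos hc₃pos.le hTQ (fun h1 => ?_) ?_ le_rfl ?_
    · rw [h1]
      simpa [DPMD.iter] using DPMD.bfbe_le_gap hr hl hS hbdd hx
    · rw [hveq, hQdef, div_pow, mul_pow, Real.sq_sqrt (by positivity)]
      field_simp
    · have h1 := DPMD.sum_bfbe_le hr hl hS hbdd hx b T
      have h2 : T * Real.log (d * √2) + Lb ≤ T * (Ld * Lb * c₃) := by
        have h3 : Ld ≤ Ld * Lb / κ := by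
          rw [le_div_iff₀ hκ]
          exact mul_le_mul_of_nonneg_left hκβ hLd.le
        have h4 : Lb ≤ 2 * (Ld * Lb) := by nlinarith
        have h5 : Ld * Lb * c₃ = 3 / 2 * (Ld * Lb / κ) + 2 * (Ld * Lb) := by
          rw [hc₃]; field_simp
        have h6 : (1 : ℝ) ≤ T := by exact_mod_cast hTpos
        rw [h5]
        nlinarith [mul_pos hLd hLb]
      have h7 : (4 : ℝ) * v * (T * Real.log (d * √2) + Lb) ≤ 4 * v * (T * (Ld * Lb * c₃)) :=
        mul_le_mul_of_nonneg_left h2 (by positivity)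
      calc _ ≤ (1 / (T : ℝ)) * (10 * l * g + 20 * v * (T * (Ld * Lb * c₃))) :=
            mul_le_mul_of_nonneg_left (by linarith) (by positivity)
        _ = _ := by field_simp
  have hbase : 0 ≤ (10 + 40 * c₂ * c₃) * (Q * √l) := by positivity
  refine ⟨fun hgap => main.trans (measure_mono fun b hb => ?_),
    main.trans (measure_mono fun b hb => ?_)⟩
  · rw [mem_ofPred_eq] at hb ⊢
    refine hb.trans (le_of_eq ?_)
    rw [hgap, Real.div_sqrt, show l * Λ * Ld * L * Lb = l * (Λ * (Ld * L * Lb)) by ring,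
      Real.sqrt_mul hl.le, Real.sqrt_mul hΛ.le, hQdef]
    ring
  · rw [mem_ofPred_eq] at hb ⊢
    refine hb.trans ?_
    rw [show l * Ld * L * Lb = l * (Ld * L * Lb) by ring, Real.sqrt_mul hl.le,
      show G * (√l * √(Ld * L * Lb)) / (n * ε) = Q * √l by rw [hQdef]; ring]
    refine mul_le_mul_of_nonneg_right ?_ (by positivity)
    rw [mul_assoc]
    linarith
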